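/- Let $N\ge 1$ and $m\ge 1$ be integers and let $\Omega\subsetneq\mathbb R^N$ be a nonempty open convex set such that $d(x)=\mathrm{dist}(x,\partial\Omega)$ is bounded on $\Omega$. For $s\in(0,1]$ put $X_1(s)=(1-\log s)^{-1}$ and $X_i(s)=X_1(X_{i-1}(s))$ for $i\ge 2$, and let \[ A(m)=\frac{1^2\cdot 3^2\cdots(2m-1)^2}{4^m},\qquad B(m)=\frac{1}{4^m}\sum_{i=1}^m\ \prod_{\substack{k=1\\ k\ne i}}^m(2k-1)^2 \] (empty products equal one). Then there exists $D\ge\sup_\Omega d$ such that for all real-valued $u\in C_c^\infty(\Omega)$ the series below converges and \[ \int_\Omega(\Delta^{m/2}u)^2\,dx\ \ge\ A(m)\int_\Omega\frac{u^2}{d^{2m}}\,dx +B(m)\sum_{i=1}^\infty\int_\Omega\frac{u^2}{d^{2m}}\,X_1^2(d/D)\cdots X_i^2(d/D)\,dx , \] where for odd $m$ the left-hand side stands for $\int_\Omega|\nabla\Delta^{(m-1)/2}u|^2\,dx$. -/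

import Mathlib

open scoped ContDiff
open MeasureTheory

namespace HardyRellich

/-- The Euclidean distance `d(x) = dist(x, ∂Ω)` to the boundary of `Ω`
(used only for `Ω` with nonempty boundary). -/
noncomputable def bdist {N : ℕ} (Ω : Set (EuclideanSpace ℝ (Fin N)))
    (x : EuclideanSpace ℝ (Fin N)) : ℝ :=
  Metric.infDist x (frontier Ω)

/-- The iterated logarithmic functions: `X 1 s = (1 - log s)⁻¹` and `X i s = X 1 (X (i - 1) s)`
for `i ≥ 2` and `0 < s ≤ 1`.  The recursion is started with the auxiliary value `X 0 s = s`. -/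
noncomputable def X : ℕ → ℝ → ℝ
  | 0, s => s
  | i + 1, s => (1 - Real.log (X i s))⁻¹

/-- `X_1(s)² X_2(s)² ⋯ X_i(s)²`. -/
noncomputable def logWeight (i : ℕ) (s : ℝ) : ℝ :=
  ∏ j ∈ Finset.Icc 1 i, X j s ^ 2

/-- `A(m) = 1² · 3² ⋯ (2m-1)² / 4^m`. -/
noncomputable def A (m : ℕ) : ℝ :=
  (∏ k ∈ Finset.Icc 1 m, (2 * (k : ℝ) - 1) ^ 2) / 4 ^ m

/-- `B(m) = 4^{-m} ∑_{i=1}^m ∏_{1 ≤ k ≤ m, k ≠ i} (2k-1)²`. -/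
noncomputable def B (m : ℕ) : ℝ :=
  1 / 4 ^ m * ∑ i ∈ Finset.Icc 1 m, ∏ k ∈ (Finset.Icc 1 m).erase i, (2 * (k : ℝ) - 1) ^ 2

/-- The `j`-fold iterate `Δ^j u` of the Laplacian. -/
noncomputable def iterLaplacian {N : ℕ} (j : ℕ) (u : EuclideanSpace ℝ (Fin N) → ℝ) :
    EuclideanSpace ℝ (Fin N) → ℝ :=
  (fun v : EuclideanSpace ℝ (Fin N) → ℝ => Laplacian.laplacian v)^[j] u

/-- `∫_Ω (Δ^{m/2} u)² dx`, which for odd `m` stands for `∫_Ω |∇ Δ^{(m-1)/2} u|² dx`. -/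
noncomputable def energy {N : ℕ} (m : ℕ) (Ω : Set (EuclideanSpace ℝ (Fin N)))
    (u : EuclideanSpace ℝ (Fin N) → ℝ) : ℝ :=
  if Even m then ∫ x in Ω, iterLaplacian (m / 2) u x ^ 2
  else ∫ x in Ω, ‖gradient (iterLaplacian ((m - 1) / 2) u) x‖ ^ 2

end HardyRellich

/-! The proof reduces to one dimension by averaging over directions. Since the symbol of `∂_v` is
`2πi⟨ξ, v⟩`, Plancherel and rotation invariance show that the integral of `‖∂_v^m u‖²` over `v` in
the unit ball is a fixed moment `ballMoment m e` times the energy, for even and odd `m` alike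
(`lintegral_ball_iterate_lineDeriv`).

On an interval, `rellich_interval` gives the inequality with the same constants. It iterates a
weighted Hardy inequality with logarithmic remainder (`weighted_hardy`), and `A` and `B` satisfy
exactly the recursion that this produces. All estimates are uniform in the number `n` of logarithmic
terms, because the sums `X_1 + X_1 X_2 + ⋯` solve a Riccati inequality.

Back in `Ω`, the weight along direction `v` at `x` is the inverse `2m`-th power of the exit
distance. Convexity gives a supporting half space with normal `e'` at a nearest boundary point, so
the exit distance is at most `d(x) / |⟨e', v⟩|`, and averaging over `v` turns the directional weight
into `d^{-2m}` with the sharp constant.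

The logarithmic factors need one `D` for all directions. A convex set with bounded `d` lies in a
slab of width `W` and normal `e` (`exists_slab`), so slices have length at most `W / |⟨e, v⟩|`,
which is unbounded as `v` turns parallel to the slab. The sum of the log weights is convex in `log
s`, so a tangent line bounds it below, and the loss `log |⟨e, v⟩|` is integrable over the ball; a
large enough `D` absorbs it (`ofReal_le_lintegral_lineWeight`). The infinite series then follows
from bounded partial sums. -/

namespace HardyRellich

/-! ### Calculus of the iterated logarithms, uniformly in the number of terms. -/

/-- `X_1(s) ⋯ X_i(s)`. -/
noncomputable def logProd (i : ℕ) (s : ℝ) : ℝ := ∏ j ∈ Finset.Icc 1 i, X j s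

/-- `∑_{i=1}^n X_1(s) ⋯ X_i(s)`. -/
noncomputable def logSum (n : ℕ) (s : ℝ) : ℝ := ∑ i ∈ Finset.range n, logProd (i + 1) s

/-- `∑_{i=1}^n X_1(s)² ⋯ X_i(s)²`. -/
noncomputable def weightSum (n : ℕ) (s : ℝ) : ℝ := ∑ i ∈ Finset.range n, logWeight (i + 1) s

/-- The derivative `s S'(s)` of the sum `S` of the squared products with respect to `log s`. -/
noncomputable def weightSlope (n : ℕ) (s : ℝ) : ℝ :=
  ∑ i ∈ Finset.range n, 2 * logProd (i + 1) s ^ 2 * logSum (i + 1) s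

lemma logWeight_eq (i : ℕ) (s : ℝ) : logWeight i s = logProd i s ^ 2 := by
  simp [logWeight, logProd, Finset.prod_pow]

lemma logProd_zero (s : ℝ) : logProd 0 s = 1 := by simp [logProd]

lemma logProd_succ (i : ℕ) (s : ℝ) : logProd (i + 1) s = logProd i s * X (i + 1) s := by
  rw [logProd, Finset.prod_Icc_succ_top (by omega)]; rfl

lemma logProd_one (s : ℝ) : logProd 1 s = X 1 s := by
  rw [logProd_succ, logProd_zero, one_mul]

lemma logSum_succ (n : ℕ) (s : ℝ) : logSum (n + 1) s = logSum n s + logProd (n + 1) s :=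
  Finset.sum_range_succ _ _

lemma weightSum_succ (n : ℕ) (s : ℝ) :
    weightSum (n + 1) s = weightSum n s + logProd (n + 1) s ^ 2 := by
  rw [weightSum, Finset.sum_range_succ, logWeight_eq]; rfl

lemma X_mem {s : ℝ} (h0 : 0 < s) (h1 : s ≤ 1) (i : ℕ) : 0 < X i s ∧ X i s ≤ 1 := by
  induction i with
  | zero => exact ⟨h0, h1⟩
  | succ i ih =>
    have hl := Real.log_nonpos ih.1.le ih.2
    exact ⟨inv_pos.2 (by linarith), inv_le_one_of_one_le₀ (by linarith)⟩

lemma X_le_X {s t : ℝ} (h0 : 0 < s) (hst : s ≤ t) (h1 : t ≤ 1) (i : ℕ) : X i s ≤ X i t := by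
  induction i with
  | zero => exact hst
  | succ i ih =>
    have hl := Real.log_nonpos (X_mem (h0.trans_le hst) h1 i).1.le (X_mem (h0.trans_le hst) h1 i).2
    have := Real.log_le_log (X_mem h0 (hst.trans h1) i).1 ih
    exact inv_anti₀ (by linarith) (by linarith)

lemma X_succ' (i : ℕ) (s : ℝ) : X (i + 1) s = X i (X 1 s) := by
  induction i with
  | zero => rfl
  | succ i ih =>
    change (1 - Real.log (X (i + 1) s))⁻¹ = (1 - Real.log (X i (X 1 s)))⁻¹
    rw [ih]

lemma logProd_pos {s : ℝ} (h0 : 0 < s) (h1 : s ≤ 1) (i : ℕ) : 0 < logProd i s :=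
  Finset.prod_pos fun j _ => (X_mem h0 h1 j).1

lemma logProd_le {s t : ℝ} (h0 : 0 < s) (hst : s ≤ t) (h1 : t ≤ 1) (i : ℕ) :
    logProd i s ≤ logProd i t :=
  Finset.prod_le_prod (fun j _ => (X_mem h0 (hst.trans h1) j).1.le)
    fun j _ => X_le_X h0 hst h1 j

lemma logProd_succ' (i : ℕ) (s : ℝ) : logProd (i + 1) s = X 1 s * logProd i (X 1 s) := by
  induction i with
  | zero => rw [logProd_succ, logProd_zero, logProd_zero]; ring
  | succ i ih => rw [logProd_succ, ih, logProd_succ i, X_succ' (i + 1)]; ring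

lemma logProd_succ_le {s : ℝ} (h0 : 0 < s) (h1 : s ≤ 1) (i : ℕ) :
    logProd (i + 1) s ≤ X 1 s := by
  induction i with
  | zero => rw [logProd_one]
  | succ i ih =>
    rw [logProd_succ]
    exact (mul_le_of_le_one_right (logProd_pos h0 h1 _).le (X_mem h0 h1 _).2).trans ih

lemma logSum_nonneg {s : ℝ} (h0 : 0 < s) (h1 : s ≤ 1) (n : ℕ) : 0 ≤ logSum n s :=
  Finset.sum_nonneg fun _ _ => (logProd_pos h0 h1 _).le

lemma logSum_le {s t : ℝ} (h0 : 0 < s) (hst : s ≤ t) (h1 : t ≤ 1) (n : ℕ) :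
    logSum n s ≤ logSum n t :=
  Finset.sum_le_sum fun _ _ => logProd_le h0 hst h1 _

/-- Self-similarity: factoring out `X_1` leaves the same sum at `X_1(s)`. A crude bound there
improves to a bound by a multiple of `X_1(s)`. -/
lemma logSum_succ' (n : ℕ) (s : ℝ) :
    logSum (n + 1) s = X 1 s * (1 + logSum n (X 1 s)) := by
  rw [logSum, Finset.sum_range_succ', logProd_one, mul_add, mul_one, add_comm, logSum,
    Finset.mul_sum]
  simp only [logProd_succ' (_ + 1)]

lemma weightSum_nonneg (n : ℕ) (s : ℝ) : 0 ≤ weightSum n s :=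
  Finset.sum_nonneg fun i _ => by rw [logWeight_eq]; positivity

lemma weightSum_le {s t : ℝ} (h0 : 0 < s) (hst : s ≤ t) (h1 : t ≤ 1) (n : ℕ) :
    weightSum n s ≤ weightSum n t :=
  Finset.sum_le_sum fun i _ => by
    rw [logWeight_eq, logWeight_eq]
    exact pow_le_pow_left₀ (logProd_pos h0 (hst.trans h1) _).le (logProd_le h0 hst h1 _) 2

lemma weightSum_le_mul {s : ℝ} (h0 : 0 < s) (h1 : s ≤ 1) (n : ℕ) :
    weightSum n s ≤ X 1 s * logSum n s := by
  rw [weightSum, logSum, Finset.mul_sum]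
  refine Finset.sum_le_sum fun i _ => ?_
  rw [logWeight_eq, sq]
  exact mul_le_mul_of_nonneg_right (logProd_succ_le h0 h1 i) (logProd_pos h0 h1 _).le

lemma weightSlope_nonneg {s : ℝ} (h0 : 0 < s) (h1 : s ≤ 1) (n : ℕ) : 0 ≤ weightSlope n s :=
  Finset.sum_nonneg fun i _ => mul_nonneg (by positivity) (logSum_nonneg h0 h1 _)

lemma weightSlope_le {s t : ℝ} (h0 : 0 < s) (hst : s ≤ t) (h1 : t ≤ 1) (n : ℕ) :
    weightSlope n s ≤ weightSlope n t := by
  refine Finset.sum_le_sum fun i _ => ?_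
  have hP := (logProd_pos h0 (hst.trans h1) (i + 1)).le
  exact mul_le_mul (by gcongr; exact logProd_le h0 hst h1 _) (logSum_le h0 hst h1 _)
    (logSum_nonneg h0 (hst.trans h1) _) (by positivity)

lemma weightSlope_le_mul {s : ℝ} (h0 : 0 < s) (h1 : s ≤ 1) (n : ℕ) :
    weightSlope n s ≤ 2 * weightSum n s * logSum n s := by
  rw [weightSlope, weightSum, Finset.mul_sum, Finset.sum_mul]
  refine Finset.sum_le_sum fun i hi => ?_
  rw [logWeight_eq]
  refine mul_le_mul_of_nonneg_left ?_ (by positivity)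
  rw [logSum, logSum]
  exact Finset.sum_le_sum_of_subset_of_nonneg
    (Finset.range_mono (Finset.mem_range.1 hi)) fun j _ _ => (logProd_pos h0 h1 _).le

lemma continuousOn_X (i : ℕ) : ContinuousOn (X i) (Set.Ioc 0 1) := by
  induction i with
  | zero => exact continuousOn_id
  | succ i ih =>
    refine ContinuousOn.inv₀ (continuousOn_const.sub (ih.log fun s hs => ?_)) fun s hs => ?_
    · exact (X_mem hs.1 hs.2 i).1.ne'
    · have := Real.log_nonpos (X_mem hs.1 hs.2 i).1.le (X_mem hs.1 hs.2 i).2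
      linarith

lemma continuousOn_logProd (i : ℕ) : ContinuousOn (logProd i) (Set.Ioc 0 1) :=
  continuousOn_finsetProd _ fun j _ => continuousOn_X j

lemma measurable_X (i : ℕ) : Measurable (X i) := by
  induction i with
  | zero => exact measurable_id
  | succ i ih => exact (measurable_const.sub (Real.measurable_log.comp ih)).inv

lemma measurable_weightSum (n : ℕ) : Measurable (weightSum n) :=
  Finset.measurable_sum _ fun _ _ =>
    Finset.measurable_prod _ fun j _ => (measurable_X j).pow_const 2

/-- The operator `s d/ds` maps polynomials in the `X_i`, `i ≥ 1`, to polynomials in them. The case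
`i = 0` fits because `X 0 s = s` and the empty product is one. -/
lemma hasDerivAt_X {s : ℝ} (h0 : 0 < s) (h1 : s ≤ 1) (i : ℕ) :
    HasDerivAt (X i) (X i s * logProd i s / s) s := by
  induction i with
  | zero =>
    rw [logProd_zero]
    have : X 0 s * 1 / s = 1 := by rw [mul_one]; exact div_self h0.ne'
    rw [this]; exact hasDerivAt_id s
  | succ i ih =>
    have hX := X_mem h0 h1 i
    have hl := Real.log_nonpos hX.1.le hX.2
    have h := ((hasDerivAt_const s (1 : ℝ)).sub (ih.log hX.1.ne')).inv
      (by simp only [Pi.sub_apply]; linarith)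
    refine h.congr_deriv ?_
    have e : X (i + 1) s = (1 - Real.log (X i s))⁻¹ := rfl
    rw [logProd_succ, e]
    simp only [Pi.sub_apply]
    have h3 : (1 - Real.log (X i s)) ≠ 0 := by linarith
    field_simp [hX.1.ne', h3]
    ring

lemma hasDerivAt_logProd {s : ℝ} (h0 : 0 < s) (h1 : s ≤ 1) (i : ℕ) :
    HasDerivAt (logProd i) (logProd i s * logSum i s / s) s := by
  induction i with
  | zero =>
    have : logProd 0 = fun _ => 1 := funext logProd_zero
    rw [this]
    simpa [logSum] using hasDerivAt_const s (1 : ℝ)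
  | succ i ih =>
    have : logProd (i + 1) = fun s => logProd i s * X (i + 1) s := funext (logProd_succ i)
    rw [logSum_succ, logProd_succ, this]
    refine (ih.mul (hasDerivAt_X h0 h1 (i + 1))).congr_deriv ?_
    rw [logProd_succ]; ring

/-- With `P_i = X_1 ⋯ X_i`, the derivative is the sum of `P_i P_j` over `j ≤ i`: half the full
square plus half the diagonal. -/
lemma hasDerivAt_logSum {s : ℝ} (h0 : 0 < s) (h1 : s ≤ 1) (n : ℕ) :
    HasDerivAt (logSum n) ((logSum n s ^ 2 + weightSum n s) / 2 / s) s := by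
  induction n with
  | zero =>
    have : logSum 0 = fun _ => 0 := funext fun s => by simp [logSum]
    rw [this]
    simpa [weightSum] using hasDerivAt_const s (0 : ℝ)
  | succ i ih =>
    have : logSum (i + 1) = fun s => logSum i s + logProd (i + 1) s := funext (logSum_succ i)
    rw [weightSum_succ, logSum_succ, this]
    refine (ih.add (hasDerivAt_logProd h0 h1 (i + 1))).congr_deriv ?_
    rw [logSum_succ]; ring

lemma hasDerivAt_weightSum {s : ℝ} (h0 : 0 < s) (h1 : s ≤ 1) (n : ℕ) :
    HasDerivAt (weightSum n) (weightSlope n s / s) s := by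
  have h : HasDerivAt (fun s => ∑ i ∈ Finset.range n, logProd (i + 1) s ^ 2)
      (∑ i ∈ Finset.range n, 2 * logProd (i + 1) s ^ 2 * logSum (i + 1) s / s) s := by
    refine HasDerivAt.fun_sum fun i _ => ?_
    refine ((hasDerivAt_logProd h0 h1 (i + 1)).pow 2).congr_deriv ?_
    norm_num; ring
  have e : weightSum n = fun s => ∑ i ∈ Finset.range n, logProd (i + 1) s ^ 2 :=
    funext fun s => by simp only [weightSum, logWeight_eq]
  rw [e, weightSlope, Finset.sum_div]
  exact h

/-- The Riccati inequality `s Q' ≥ Q² / 2` bounds `Q` uniformly in the number of summands. -/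
lemma logSum_le_two_div {s : ℝ} (h0 : 0 < s) (h1 : s < 1) (n : ℕ) :
    logSum n s ≤ 2 / (-Real.log s) := by
  have hlog : 0 < -Real.log s := neg_pos.2 (Real.log_neg h0 h1)
  rcases n with _ | n
  · simp only [logSum, Finset.range_zero, Finset.sum_empty]; positivity
  have hQ : ∀ r ∈ Set.Icc s 1, 0 < logSum (n + 1) r := fun r hr => by
    rw [logSum_succ']
    have hm := X_mem (h0.trans_le hr.1) hr.2 1
    have := logSum_nonneg hm.1 hm.2 n
    exact mul_pos hm.1 (by linarith)
  have hsub : Set.Icc s 1 ⊆ Set.Ioc 0 1 := fun r hr => ⟨h0.trans_le hr.1, hr.2⟩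
  have hder : ∀ r ∈ Set.Icc s 1, HasDerivAt (fun r => (logSum (n + 1) r)⁻¹ + Real.log r / 2)
      (-((logSum (n + 1) r ^ 2 + weightSum (n + 1) r) / 2 / r) / logSum (n + 1) r ^ 2
        + r⁻¹ / 2) r := fun r hr =>
    ((hasDerivAt_logSum (hsub hr).1 hr.2 (n + 1)).inv (hQ r hr).ne').add
      ((Real.hasDerivAt_log (hsub hr).1.ne').div_const 2)
  -- `s Q' ≥ Q² / 2` says that `1/Q + (log s)/2` decreases; comparison with the value at `1`, which
  -- is positive, gives the bound.
  have hanti : AntitoneOn (fun r => (logSum (n + 1) r)⁻¹ + Real.log r / 2) (Set.Icc s 1) := by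
    refine antitoneOn_of_deriv_nonpos (convex_Icc _ _)
      (fun r hr => (hder r hr).continuousAt.continuousWithinAt)
      (fun r hr => (hder r (interior_subset hr)).differentiableAt.differentiableWithinAt) ?_
    intro r hr
    have hr := interior_subset hr
    rw [(hder r hr).deriv]
    have hq := hQ r hr
    have hr0 := (hsub hr).1
    have hS := weightSum_nonneg (n + 1) r
    have : -((logSum (n + 1) r ^ 2 + weightSum (n + 1) r) / 2 / r) / logSum (n + 1) r ^ 2
        + r⁻¹ / 2 = - (weightSum (n + 1) r / (2 * r * logSum (n + 1) r ^ 2)) := by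
      field_simp; ring
    rw [this]
    exact neg_nonpos.2 (by positivity)
  have h := hanti (Set.left_mem_Icc.2 h1.le) (Set.right_mem_Icc.2 h1.le) h1.le
  have hpos := hQ 1 (Set.right_mem_Icc.2 h1.le)
  have hq := hQ s (Set.left_mem_Icc.2 h1.le)
  simp only [Real.log_one, zero_div, add_zero] at h
  have h3 : (-Real.log s) / 2 ≤ (logSum (n + 1) s)⁻¹ := by
    have := inv_pos.2 hpos; linarith
  have := inv_anti₀ (by positivity) h3
  rwa [inv_inv, inv_div] at this

lemma X_one_le {y s : ℝ} (hy : 0 < y) (h0 : 0 < s) (hs : s ≤ Real.exp (1 - y⁻¹)) : X 1 s ≤ y := by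
  have h : Real.log s ≤ 1 - y⁻¹ := (Real.log_le_iff_le_exp h0).2 hs
  change (1 - Real.log s)⁻¹ ≤ y
  rw [← inv_inv y]
  exact inv_anti₀ (inv_pos.2 hy) (by linarith)

/-- Near zero the whole sum is comparable to its first term, with `δ` independent of `n`. Once
`X_1(s) ≤ e^{-4}`, the Riccati bound at `X_1(s)` is at most `2/4`, and self-similarity gives `1 +
1/2`. -/
lemma exists_logSum_le {η : ℝ} (hη : 0 < η) :
    ∃ δ : ℝ, 0 < δ ∧ δ < 1 ∧ ∀ s : ℝ, 0 < s → s ≤ δ →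
      X 1 s ≤ η ∧ ∀ n, logSum n s ≤ 3 / 2 * X 1 s := by
  have hy : 0 < min (min η (Real.exp (-4))) (1 / 2) := by positivity
  set y := min (min η (Real.exp (-4))) (1 / 2) with hydef
  have hy1 : y ≤ η := (min_le_left _ _).trans (min_le_left _ _)
  have hy2 : y ≤ Real.exp (-4) := (min_le_left _ _).trans (min_le_right _ _)
  have hy3 : y ≤ 1 / 2 := min_le_right _ _
  have hinv : 1 < y⁻¹ := by
    have := inv_anti₀ hy hy3
    norm_num at this; linarith
  refine ⟨Real.exp (1 - y⁻¹), Real.exp_pos _, by rw [Real.exp_lt_one_iff]; linarith, ?_⟩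
  intro s h0 hs
  have hs1 : s ≤ 1 := hs.trans (by rw [Real.exp_le_one_iff]; linarith)
  have hX := X_one_le hy h0 hs
  have hXm := X_mem h0 hs1 1
  refine ⟨hX.trans hy1, fun n => ?_⟩
  rcases n with _ | n
  · simp only [logSum, Finset.range_zero, Finset.sum_empty]; linarith [hXm.1]
  have hlog : Real.log (X 1 s) ≤ -4 := (Real.log_le_iff_le_exp hXm.1).2 (hX.trans hy2)
  have h := logSum_le_two_div hXm.1 (by linarith) n
  have h2 : 2 / (-Real.log (X 1 s)) ≤ 1 / 2 := by
    rw [div_le_iff₀ (by linarith)]; linarith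
  rw [logSum_succ', mul_comm]
  exact mul_le_mul_of_nonneg_right (by linarith) hXm.1.le

/-- `weightSum n` is a convex function of `log s`: the tangent line inequality. -/
lemma weightSum_tangent {s r : ℝ} (hs0 : 0 < s) (hs1 : s ≤ 1) (hr0 : 0 < r) (hr1 : r ≤ 1) (n : ℕ) :
    weightSum n r + weightSlope n r * (Real.log s - Real.log r) ≤ weightSum n s := by
  let F : ℝ → ℝ := fun t => weightSum n t - weightSlope n r * Real.log t
  have hder : ∀ t ∈ Set.Ioc (0 : ℝ) 1,
      HasDerivAt F ((weightSlope n t - weightSlope n r) / t) t := fun t ht =>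
    ((hasDerivAt_weightSum ht.1 ht.2 n).sub
      ((Real.hasDerivAt_log ht.1.ne').const_mul _)).congr_deriv (by ring)
  suffices h : F r ≤ F s by simp only [F] at h; linarith
  rcases le_total r s with h | h
  · have hsub : Set.Icc r s ⊆ Set.Ioc 0 1 := fun t ht => ⟨hr0.trans_le ht.1, ht.2.trans hs1⟩
    refine monotoneOn_of_deriv_nonneg (convex_Icc r s)
      (fun t ht => (hder t (hsub ht)).continuousAt.continuousWithinAt)
      (fun t ht => (hder t (hsub (interior_subset ht))).differentiableAt.differentiableWithinAt)
      (fun t ht => ?_) (Set.left_mem_Icc.2 h) (Set.right_mem_Icc.2 h) h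
    have ht := interior_subset ht
    rw [(hder t (hsub ht)).deriv]
    exact div_nonneg (sub_nonneg.2 (weightSlope_le hr0 ht.1 (hsub ht).2 n)) (hsub ht).1.le
  · have hsub : Set.Icc s r ⊆ Set.Ioc 0 1 := fun t ht => ⟨hs0.trans_le ht.1, ht.2.trans hr1⟩
    refine antitoneOn_of_deriv_nonpos (convex_Icc s r)
      (fun t ht => (hder t (hsub ht)).continuousAt.continuousWithinAt)
      (fun t ht => (hder t (hsub (interior_subset ht))).differentiableAt.differentiableWithinAt)
      (fun t ht => ?_) (Set.left_mem_Icc.2 h) (Set.right_mem_Icc.2 h) h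
    have ht := interior_subset ht
    rw [(hder t (hsub ht)).deriv]
    exact div_nonpos_of_nonpos_of_nonneg
      (sub_nonpos.2 (weightSlope_le (hsub ht).1 ht.2 hr1 n)) (hsub ht).1.le

/-! ### The weighted Hardy inequality on a half interval. -/

/-- The algebraic core of the weighted Hardy inequality: `x, Q, S, R` stand for `X_1`,
`∑ X_1 ⋯ X_i`, `∑ X_1² ⋯ X_i²` and the logarithmic derivative of the latter. -/
lemma hardy_algebra {α β κ x Q S R a t w v : ℝ} (hα : 0 < α) (hβ : 0 ≤ β) (hκ : 0 ≤ κ)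
    (hx : 0 < x) (hQ0 : 0 ≤ Q) (hQ : Q ≤ 3 / 2 * x) (hS0 : 0 ≤ S) (hS : S ≤ x * Q)
    (hR0 : 0 ≤ R) (hR : R ≤ 2 * S * Q) (ha : a = 18 * β * κ / α) (hax : a * x ≤ 1 / 4) :
    (β * R * (κ - Q / 2 - a * x ^ 2) + (α + β * S) * (-(Q ^ 2 + S) / 4 - 2 * a * x ^ 3)
        - (2 * κ) * ((α + β * S) * (κ - Q / 2 - a * x ^ 2))) * w ^ 2
      + (α + β * S) * (κ - Q / 2 - a * x ^ 2) * (2 * w * (t * v)) ≤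
    (α + β * S) * (t * v) ^ 2 - (α * κ ^ 2 + (α / 4 + β * κ ^ 2) * S) * w ^ 2 := by
  set c := κ - Q / 2 - a * x ^ 2 with hc
  have ha0 : 0 ≤ a := by rw [ha]; positivity
  have haα : a * α = 18 * β * κ := by rw [ha]; field_simp
  have hS' : S ≤ 3 / 2 * x ^ 2 := by nlinarith
  have hR' : R ≤ 9 / 2 * x ^ 3 := by
    have : S * Q ≤ (3 / 2 * x ^ 2) * (3 / 2 * x) := mul_le_mul hS' hQ hQ0 (by positivity)
    nlinarith
  have hβS : 0 ≤ β * S := mul_nonneg hβ hS0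
  have h1 : a * x ^ 3 / 4 ≤ a * x ^ 2 * (2 * x - Q - a * x ^ 2) := by
    have h : x / 4 ≤ 2 * x - Q - a * x ^ 2 := by nlinarith
    have := mul_le_mul_of_nonneg_left h (mul_nonneg ha0 (sq_nonneg x))
    nlinarith
  have h2 : α * (a * x ^ 3 / 4) ≤ (α + β * S) * (a * x ^ 2 * (2 * x - Q - a * x ^ 2)) :=
    mul_le_mul (by linarith) h1 (by positivity) (by linarith)
  have h3 : β * R * c ≤ β * (9 / 2 * x ^ 3) * κ := by
    have hcκ : c ≤ κ := by
      have : 0 ≤ a * x ^ 2 := by positivity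
      rw [hc]; linarith
    calc β * R * c ≤ β * R * κ := mul_le_mul_of_nonneg_left hcκ (mul_nonneg hβ hR0)
      _ ≤ _ := by gcongr
  have h4 : 0 ≤ β * S ^ 2 / 4 + (α + β * S) * (a * x ^ 2 * (2 * x - Q - a * x ^ 2))
      - β * R * c := by
    -- This dictates `a = 18 β κ / α`: the gain from the correction `a x²` pays exactly for the term
    -- `β R c` created by differentiating the weight.
    have : α * (a * x ^ 3 / 4) = β * (9 / 2 * x ^ 3) * κ := by
      linear_combination (x ^ 3 / 4) * haα
    have : 0 ≤ β * S ^ 2 / 4 := by positivity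
    linarith
  have h5 : 0 ≤ (α + β * S) * (t * v - c * w) ^ 2 := by positivity
  have h6 := mul_nonneg h4 (sq_nonneg w)
  -- Completing the square: the difference of the two sides is a square plus the remainder
  -- controlled by `h4`.
  have key : (α + β * S) * (t * v) ^ 2 - (α * κ ^ 2 + (α / 4 + β * κ ^ 2) * S) * w ^ 2
      - ((β * R * c + (α + β * S) * (-(Q ^ 2 + S) / 4 - 2 * a * x ^ 3)
        - (2 * κ) * ((α + β * S) * c)) * w ^ 2 + (α + β * S) * c * (2 * w * (t * v)))
      = (α + β * S) * (t * v - c * w) ^ 2 + (β * S ^ 2 / 4 + (α + β * S) *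
        (a * x ^ 2 * (2 * x - Q - a * x ^ 2)) - β * R * c) * w ^ 2 := by
    rw [hc]; ring
  linarith

lemma hasDerivAt_weightSum_div {D t : ℝ} (hD : 0 < D) (ht : 0 < t) (h1 : t / D ≤ 1) (n : ℕ) :
    HasDerivAt (fun t => weightSum n (t / D)) (weightSlope n (t / D) / t) t := by
  refine ((hasDerivAt_weightSum (div_pos ht hD) h1 n).comp t
    ((hasDerivAt_id t).div_const D)).congr_deriv ?_
  field_simp

lemma hasDerivAt_logSum_div {D t : ℝ} (hD : 0 < D) (ht : 0 < t) (h1 : t / D ≤ 1) (n : ℕ) :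
    HasDerivAt (fun t => logSum n (t / D))
      ((logSum n (t / D) ^ 2 + weightSum n (t / D)) / 2 / t) t := by
  refine ((hasDerivAt_logSum (div_pos ht hD) h1 n).comp t
    ((hasDerivAt_id t).div_const D)).congr_deriv ?_
  field_simp

lemma hasDerivAt_X_one_div {D t : ℝ} (hD : 0 < D) (ht : 0 < t) (h1 : t / D ≤ 1) :
    HasDerivAt (fun t => X 1 (t / D)) (X 1 (t / D) ^ 2 / t) t := by
  refine ((hasDerivAt_X (div_pos ht hD) h1 1).comp t
    ((hasDerivAt_id t).div_const D)).congr_deriv ?_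
  rw [logProd_one]
  field_simp

lemma continuousOn_weightSum_div {D ε L : ℝ} (hD : 0 < D) (hε : 0 < ε) (hL : L ≤ D) (n : ℕ) :
    ContinuousOn (fun t => weightSum n (t / D)) (Set.Icc ε L) := fun _ ht =>
  (hasDerivAt_weightSum_div hD (hε.trans_le ht.1)
    ((div_le_one hD).2 (ht.2.trans hL)) n).continuousAt.continuousWithinAt

/-- The weighted Hardy inequality with logarithmic remainder terms on a half interval, for
functions that vanish at the left end only. -/
lemma weighted_hardy (k : ℕ) {α β : ℝ} (hα : 0 < α) (hβ : 0 ≤ β) :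
    ∃ δ : ℝ, 0 < δ ∧ δ < 1 ∧ ∀ (n : ℕ) (D ε L : ℝ) (w w' : ℝ → ℝ), 0 < D → 0 < ε → ε ≤ L →
      L ≤ δ * D → (∀ t, HasDerivAt w (w' t) t) → Continuous w' → w ε = 0 →
      ∫ t in ε..L, (α * ((2 * k + 1) / 2 : ℝ) ^ 2 + (α / 4 + β * ((2 * k + 1) / 2 : ℝ) ^ 2) *
          weightSum n (t / D)) / t ^ (2 * (k + 1)) * w t ^ 2 ≤
        ∫ t in ε..L, (α + β * weightSum n (t / D)) / t ^ (2 * k) * w' t ^ 2 := by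
  set κ : ℝ := (2 * k + 1) / 2 with hκdef
  have hκ : 1 / 2 ≤ κ := by
    rw [hκdef]; have : (0 : ℝ) ≤ k := Nat.cast_nonneg k; linarith
  set a : ℝ := 18 * β * κ / α with ha
  have ha0 : 0 ≤ a := by rw [ha]; positivity
  obtain ⟨δ, hδ0, hδ1, hδ⟩ := exists_logSum_le (η := 1 / (4 * (a + 1))) (by positivity)
  refine ⟨δ, hδ0, hδ1, ?_⟩
  intro n D ε L w w' hD hε hεL hL hw hw' hwε
  have hLD : L ≤ D := hL.trans (by nlinarith)
  have hwc : Continuous w := continuous_iff_continuousAt.2 fun t => (hw t).continuousAt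
  have hmem : ∀ t ∈ Set.Icc ε L, 0 < t ∧ 0 < t / D ∧ t / D ≤ δ := fun t ht =>
    ⟨hε.trans_le ht.1, div_pos (hε.trans_le ht.1) hD, (div_le_iff₀ hD).2 (ht.2.trans hL)⟩
  have hax : ∀ t ∈ Set.Icc ε L, X 1 (t / D) ≤ 1 / 4 ∧ a * X 1 (t / D) ≤ 1 / 4 := fun t ht => by
    obtain ⟨_, h2, h3⟩ := hmem t ht
    have h := (hδ _ h2 h3).1
    rw [le_div_iff₀ (by positivity)] at h
    have hx := (X_mem h2 (h3.trans hδ1.le) 1).1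
    constructor <;> nlinarith
  -- `κ` gives the sharp Hardy constant, `logSum / 2` the logarithmic terms, and the last term is a
  -- higher-order correction. The integrand difference dominates the derivative of `G`.
  let c : ℝ → ℝ := fun t => κ - logSum n (t / D) / 2 - a * X 1 (t / D) ^ 2
  let G : ℝ → ℝ := fun t => (α + β * weightSum n (t / D)) * c t * w t ^ 2 / t ^ (2 * k + 1)
  have hc0 : ∀ t ∈ Set.Icc ε L, 0 ≤ c t := fun t ht => by
    obtain ⟨_, h2, h3⟩ := hmem t ht
    have h := (hδ _ h2 h3).2 n
    have hx := (X_mem h2 (h3.trans hδ1.le) 1).1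
    have := hax t ht
    simp only [c]
    nlinarith
  have hG : ∀ t ∈ Set.Icc ε L, HasDerivAt G
      ((((β * weightSlope n (t / D) * c t + (α + β * weightSum n (t / D)) *
          (-(logSum n (t / D) ^ 2 + weightSum n (t / D)) / 4 - 2 * a * X 1 (t / D) ^ 3)
        - (2 * κ) * ((α + β * weightSum n (t / D)) * c t)) * w t ^ 2
      + (α + β * weightSum n (t / D)) * c t * (2 * w t * (t * w' t)))) / t ^ (2 * k + 2)) t := by
    intro t ht
    obtain ⟨h0, h2, h3⟩ := hmem t ht
    have h4 := h3.trans hδ1.le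
    have d1 := ((hasDerivAt_weightSum_div hD h0 h4 n).const_mul β).const_add α
    have d2 := (((hasDerivAt_logSum_div hD h0 h4 n).div_const 2).const_sub κ).sub
      (((hasDerivAt_X_one_div hD h0 h4).pow 2).const_mul a)
    have d3 := ((d1.mul d2).mul ((hw t).pow 2)).div (hasDerivAt_pow (2 * k + 1) t)
      (pow_ne_zero _ h0.ne')
    refine d3.congr_deriv ?_
    have e : (((2 * k + 1 : ℕ) : ℝ)) = 2 * κ := by rw [hκdef]; push_cast; ring
    simp only [Pi.mul_apply, Pi.sub_apply, Pi.pow_apply, e, c]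
    rw [show 2 * k + 1 - 1 = 2 * k by omega]
    have ht0 := h0.ne'
    have hp : t ^ (2 * k) ≠ 0 := pow_ne_zero _ ht0
    simp only [pow_succ]
    field_simp
    ring
  have hS := continuousOn_weightSum_div hD hε hLD n
  have hpow : ∀ j : ℕ, ∀ t ∈ Set.Icc ε L, t ^ j ≠ 0 := fun j t ht =>
    pow_ne_zero _ (hmem t ht).1.ne'
  have hi1 : ContinuousOn (fun t => (α * κ ^ 2 + (α / 4 + β * κ ^ 2) *
      weightSum n (t / D)) / t ^ (2 * (k + 1)) * w t ^ 2) (Set.Icc ε L) :=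
    ((continuousOn_const.add (continuousOn_const.mul hS)).div
      (continuous_pow _).continuousOn (hpow _)).mul (hwc.pow 2).continuousOn
  have hi2 : ContinuousOn (fun t => (α + β * weightSum n (t / D)) / t ^ (2 * k) * w' t ^ 2)
      (Set.Icc ε L) :=
    ((continuousOn_const.add (continuousOn_const.mul hS)).div
      (continuous_pow _).continuousOn (hpow _)).mul (hw'.pow 2).continuousOn
  have hmain := intervalIntegral.sub_le_integral_of_hasDeriv_right_of_le hεL
    (fun t ht => (hG t ht).continuousAt.continuousWithinAt)
    (fun t ht => (hG t (Set.Ioo_subset_Icc_self ht)).hasDerivWithinAt)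
    ((hi2.sub hi1).integrableOn_Icc) (fun t ht => ?_)
  · have e : ∫ t in ε..L,
        (((fun t : ℝ => (α + β * weightSum n (t / D)) / t ^ (2 * k) * w' t ^ 2) : ℝ → ℝ)
        - (fun t : ℝ => (α * κ ^ 2 + (α / 4 + β * κ ^ 2) *
      weightSum n (t / D)) / t ^ (2 * (k + 1)) * w t ^ 2) : ℝ → ℝ) t =
        (∫ t in ε..L, (α + β * weightSum n (t / D)) / t ^ (2 * k) * w' t ^ 2) -
        ∫ t in ε..L, (α * κ ^ 2 + (α / 4 + β * κ ^ 2) *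
          weightSum n (t / D)) / t ^ (2 * (k + 1)) * w t ^ 2 := by
      simp only [Pi.sub_apply]
      rw [← Set.uIcc_of_le hεL] at hi1 hi2
      exact intervalIntegral.integral_sub hi2.intervalIntegrable hi1.intervalIntegrable
    have hGε : G ε = 0 := by simp [G, hwε]
    -- The boundary term at the right end has the favourable sign, so `w` need not vanish there;
    -- this is what later allows cutting an interval at its midpoint.
    have hGL : 0 ≤ G L := by
      have hLm := Set.right_mem_Icc.2 hεL
      have h1 := hc0 L hLm
      have h2 := weightSum_nonneg n (L / D)
      have h3 := (hmem L hLm).1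
      simp only [G]; positivity
    have hmain' := hmain.trans_eq e
    linarith
  · obtain ⟨h0, h2, h3⟩ := hmem t (Set.Ioo_subset_Icc_self ht)
    have h4 := h3.trans hδ1.le
    have h := hardy_algebra (t := t) (w := w t) (v := w' t) hα hβ (by linarith : (0 : ℝ) ≤ κ)
      (X_mem h2 h4 1).1 (logSum_nonneg h2 h4 n) ((hδ _ h2 h3).2 n) (weightSum_nonneg n _)
      (weightSum_le_mul h2 h4 n) (weightSlope_nonneg h2 h4 n) (weightSlope_le_mul h2 h4 n) ha
      (hax t (Set.Ioo_subset_Icc_self ht)).2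
    have hp : 0 < t ^ (2 * k + 2) := by positivity
    refine (div_le_div_of_nonneg_right h hp.le).trans_eq ?_
    simp only [Pi.sub_apply]
    rw [show 2 * (k + 1) = 2 * k + 2 by ring]
    have hp2 : t ^ (2 * k) ≠ 0 := pow_ne_zero _ h0.ne'
    have ht0 := h0.ne'
    rw [pow_add]
    field_simp

/-! ### Recursion for the constants and the one-dimensional inequality of order `m`. -/

lemma A_zero : A 0 = 1 := by simp [A]

lemma B_zero : B 0 = 0 := by simp [B]

lemma A_succ (m : ℕ) : A (m + 1) = A m * ((2 * m + 1) / 2 : ℝ) ^ 2 := by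
  rw [A, A, Finset.prod_Icc_succ_top (by omega)]
  push_cast
  field_simp
  ring

/-- The summand omitting the new factor gives `A m / 4`; the others acquire it. This is how
`weighted_hardy` transforms its coefficients for `α = A m`, `β = B m`. -/
lemma B_succ (m : ℕ) : B (m + 1) = A m / 4 + B m * ((2 * m + 1) / 2 : ℝ) ^ 2 := by
  have h1 : ∀ i ∈ Finset.Icc 1 m, ∏ k ∈ (Finset.Icc 1 (m + 1)).erase i, (2 * (k : ℝ) - 1) ^ 2 =
      (∏ k ∈ (Finset.Icc 1 m).erase i, (2 * (k : ℝ) - 1) ^ 2) * (2 * (m : ℝ) + 1) ^ 2 := by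
    intro i hi
    have hi' := Finset.mem_Icc.1 hi
    have : (Finset.Icc 1 (m + 1)).erase i = insert (m + 1) ((Finset.Icc 1 m).erase i) := by
      ext j; simp only [Finset.mem_erase, Finset.mem_Icc, Finset.mem_insert]; omega
    rw [this, Finset.prod_insert (by simp), mul_comm]
    push_cast; ring
  have h2 : (Finset.Icc 1 (m + 1)).erase (m + 1) = Finset.Icc 1 m := by
    ext j; simp only [Finset.mem_erase, Finset.mem_Icc]; omega
  unfold A B
  rw [Finset.sum_Icc_succ_top (by omega), Finset.sum_congr rfl h1, ← Finset.sum_mul, h2]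
  field_simp
  ring

lemma A_pos (m : ℕ) : 0 < A m := by
  induction m with
  | zero => simp [A_zero]
  | succ m ih => rw [A_succ]; positivity

lemma B_nonneg (m : ℕ) : 0 ≤ B m := by
  induction m with
  | zero => simp [B_zero]
  | succ m ih => rw [B_succ]; have := A_pos m; positivity

/-- The one-dimensional inequality on a half interval. -/
lemma rellich_half_interval (m : ℕ) :
    ∃ δ : ℝ, 0 < δ ∧ δ < 1 ∧ ∀ (n : ℕ) (D ε L : ℝ) (w : ℝ → ℝ), 0 < D → 0 < ε → ε ≤ L →
      L ≤ δ * D → ContDiff ℝ ∞ w → (∀ j, iteratedDeriv j w ε = 0) →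
      ∫ t in ε..L, (A m + B m * weightSum n (t / D)) / t ^ (2 * m) * w t ^ 2 ≤
        ∫ t in ε..L, iteratedDeriv m w t ^ 2 := by
  induction m with
  | zero =>
    refine ⟨1 / 2, by norm_num, by norm_num, ?_⟩
    intro n D ε L w _ _ _ _ _ _
    simp [A_zero, B_zero]
  | succ m ih =>
    obtain ⟨δ₁, h1, h1', H1⟩ := ih
    obtain ⟨δ₂, h2, h2', H2⟩ := weighted_hardy m (A_pos m) (B_nonneg m)
    refine ⟨min δ₁ δ₂, lt_min h1 h2, (min_le_left _ _).trans_lt h1', ?_⟩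
    intro n D ε L w hD hε hεL hL hw hw0
    have hdw : ContDiff ℝ ∞ (deriv w) := (contDiff_infty_iff_deriv.1 hw).2
    have hd : ∀ t, HasDerivAt w (deriv w t) t := fun t =>
      ((contDiff_infty_iff_deriv.1 hw).1 t).hasDerivAt
    have e1 := H1 n D ε L (deriv w) hD hε hεL
      (hL.trans (mul_le_mul_of_nonneg_right (min_le_left _ _) hD.le)) hdw
      (fun j => by rw [← iteratedDeriv_succ']; exact hw0 _)
    have e2 := H2 n D ε L w (deriv w) hD hε hεL
      (hL.trans (mul_le_mul_of_nonneg_right (min_le_right _ _) hD.le)) hd hdw.continuous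
      (by simpa using hw0 0)
    -- The weighted Hardy inequality bounds `w` by `w'`, and the induction hypothesis bounds `w'` by
    -- its `m`-th derivative.
    rw [A_succ, B_succ, iteratedDeriv_succ']
    exact e2.trans e1

/-- The one-dimensional weight `t^{-2m} (A(m) + B(m) ∑_{i ≤ n} X_1² ⋯ X_i²(t / D))`. -/
noncomputable def rayWeight (m n : ℕ) (D t : ℝ) : ℝ :=
  (A m + B m * weightSum n (t / D)) / t ^ (2 * m)

/-- Lower integrals allow the left end to be the singular point `0` of the weight; all the work
happens away from it, since `w` vanishes near zero. -/
lemma rellich_half_interval_lintegral (m : ℕ) :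
    ∃ δ : ℝ, 0 < δ ∧ δ < 1 ∧ ∀ (n : ℕ) (D ε L : ℝ) (w : ℝ → ℝ), 0 < D → 0 < ε → 0 < L →
      L ≤ δ * D → ContDiff ℝ ∞ w → (∀ t < ε, w t = 0) →
      ∫⁻ t in Set.Ioo 0 L, ENNReal.ofReal (rayWeight m n D t * w t ^ 2) ≤
        ∫⁻ t in Set.Ioo 0 L, ENNReal.ofReal (iteratedDeriv m w t ^ 2) := by
  obtain ⟨δ, h0, h1, H⟩ := rellich_half_interval m
  refine ⟨δ, h0, h1, ?_⟩
  intro n D ε L w hD hε hL hLD hw hwε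
  set r := min (ε / 2) (L / 2) with hr
  have hr0 : 0 < r := by positivity
  have hrε : r < ε := (min_le_left _ _).trans_lt (by linarith)
  have hrL : r < L := (min_le_right _ _).trans_lt (by linarith)
  have hvan : ∀ j, iteratedDeriv j w r = 0 := fun j => by
    have : w =ᶠ[nhds r] fun _ => 0 := by
      filter_upwards [Iio_mem_nhds hrε] with t ht using hwε t ht
    rw [this.iteratedDeriv_eq j]
    simp
  have hmain := H n D r L w hD hr0 hrL.le hLD hw hvan
  have hS := continuousOn_weightSum_div hD hr0
    (hLD.trans (mul_le_of_le_one_left hD.le h1.le)) n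
  have hc1 : ContinuousOn (fun t => rayWeight m n D t * w t ^ 2) (Set.Icc r L) :=
    ((continuousOn_const.add (continuousOn_const.mul hS)).div
      (continuous_pow _).continuousOn
      fun t ht => pow_ne_zero _ (hr0.trans_le ht.1).ne').mul (hw.continuous.pow 2).continuousOn
  have hc2 : Continuous fun t => iteratedDeriv m w t ^ 2 :=
    (hw.continuous_iteratedDeriv m (by exact_mod_cast le_top)).pow 2
  have hA := A_pos m
  have hB := B_nonneg m
  rw [intervalIntegral.integral_of_le hrL.le, intervalIntegral.integral_of_le hrL.le] at hmain
  have hmain' := ENNReal.ofReal_le_ofReal hmain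
  rw [ofReal_integral_eq_lintegral_ofReal, ofReal_integral_eq_lintegral_ofReal] at hmain'
  · calc ∫⁻ t in Set.Ioo 0 L, ENNReal.ofReal (rayWeight m n D t * w t ^ 2)
        = ∫⁻ t in Set.Ioc 0 L, ENNReal.ofReal (rayWeight m n D t * w t ^ 2) :=
          setLIntegral_congr Ioo_ae_eq_Ioc
      _ ≤ ∫⁻ t in Set.Ioc r L, ENNReal.ofReal (rayWeight m n D t * w t ^ 2) := by
          rw [← lintegral_indicator measurableSet_Ioc, ← lintegral_indicator measurableSet_Ioc]
          refine lintegral_mono fun t => ?_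
          simp only [Set.indicator_apply, Set.mem_Ioc]
          split_ifs with h h' h'
          · exact le_rfl
          · have : t < ε := by
              by_contra hh
              exact h' ⟨by linarith, h.2⟩
            simp [hwε t this]
          · exact zero_le
          · exact le_rfl
      _ ≤ ∫⁻ t in Set.Ioc r L, ENNReal.ofReal (iteratedDeriv m w t ^ 2) := hmain'
      _ ≤ ∫⁻ t in Set.Ioc 0 L, ENNReal.ofReal (iteratedDeriv m w t ^ 2) :=
          lintegral_mono_set (Set.Ioc_subset_Ioc_left hr0.le)
      _ = _ := (setLIntegral_congr Ioo_ae_eq_Ioc).symm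
  · exact (hc2.continuousOn.integrableOn_Icc).mono_set Set.Ioc_subset_Icc_self
  · exact Filter.Eventually.of_forall fun t => sq_nonneg _
  · exact (hc1.integrableOn_Icc).mono_set Set.Ioc_subset_Icc_self
  · refine (ae_restrict_mem measurableSet_Ioc).mono fun t ht => ?_
    have := weightSum_nonneg n (t / D)
    have : 0 < t := hr0.trans ht.1
    simp only [Pi.zero_apply]
    positivity

lemma setLIntegral_Ioo_add (f : ℝ → ENNReal) (a L : ℝ) :
    ∫⁻ s in Set.Ioo 0 L, f (a + s) = ∫⁻ t in Set.Ioo a (a + L), f t := by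
  rw [← lintegral_indicator measurableSet_Ioo, ← lintegral_indicator measurableSet_Ioo,
    ← lintegral_add_left_eq_self ((Set.Ioo a (a + L)).indicator f) a]
  refine lintegral_congr fun s => ?_
  simp only [Set.indicator_apply, Set.mem_Ioo, lt_add_iff_pos_right, add_lt_add_iff_left]

lemma setLIntegral_Ioo_sub (f : ℝ → ENNReal) (b L : ℝ) :
    ∫⁻ s in Set.Ioo 0 L, f (b - s) = ∫⁻ t in Set.Ioo (b - L) b, f t := by
  rw [← lintegral_indicator measurableSet_Ioo, ← lintegral_indicator measurableSet_Ioo,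
    ← lintegral_sub_left_eq_self ((Set.Ioo (b - L) b).indicator f) b]
  refine lintegral_congr fun s => ?_
  simp only [Set.indicator_apply, Set.mem_Ioo, sub_lt_self_iff, sub_lt_sub_iff_left,
    and_comm (a := 0 < s)]

/-- The one-dimensional inequality on a bounded interval, with distance to the end points. -/
lemma rellich_interval (m : ℕ) :
    ∃ δ : ℝ, 0 < δ ∧ δ < 1 ∧ ∀ (n : ℕ) (D a b : ℝ) (v : ℝ → ℝ), 0 < D → a < b →
      b - a ≤ δ * D → ContDiff ℝ ∞ v → HasCompactSupport v → tsupport v ⊆ Set.Ioo a b →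
      ∫⁻ t in Set.Ioo a b, ENNReal.ofReal (rayWeight m n D (min (t - a) (b - t)) * v t ^ 2) ≤
        ∫⁻ t, ENNReal.ofReal (iteratedDeriv m v t ^ 2) := by
  obtain ⟨δ, h0, h1, H⟩ := rellich_half_interval_lintegral m
  refine ⟨δ, h0, h1, ?_⟩
  intro n D a b v hD hab hδ hv hvc hvs
  obtain ⟨ε, hε, hεs⟩ := hvc.isCompact.exists_cthickening_subset_open isOpen_Ioo hvs
  have hout : ∀ t, v t ≠ 0 → a + ε ≤ t ∧ t ≤ b - ε := fun t ht => by
    have hball : Metric.closedBall t ε ⊆ Set.Ioo a b :=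
      (Metric.closedBall_subset_cthickening (subset_tsupport v ht) ε).trans hεs
    have h1 := (hball (show t - ε ∈ _ by simp [abs_of_pos hε])).1
    have h2 := (hball (show t + ε ∈ _ by simp [abs_of_pos hε])).2
    constructor <;> linarith
  -- Each half is treated from its own end point, the right one after reflection; there the minimum
  -- is the distance to that end.
  set L := (b - a) / 2 with hL
  have hL0 : 0 < L := by rw [hL]; linarith
  have hLD : L ≤ δ * D := by linarith
  have e1 := H n D ε L (fun s => v (a + s)) hD hε hL0 hLD
    (hv.comp (contDiff_const.add contDiff_id)) fun t ht => by
      by_contra h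
      have := (hout _ h).1; linarith
  have e2 := H n D ε L (fun s => v (b - s)) hD hε hL0 hLD
    (hv.comp (contDiff_const.sub contDiff_id)) fun t ht => by
      by_contra h
      have := (hout _ h).2; linarith
  have i1 : ∫⁻ t in Set.Ioo a (a + L),
      ENNReal.ofReal (rayWeight m n D (min (t - a) (b - t)) * v t ^ 2) ≤
      ∫⁻ t in Set.Ioo a (a + L), ENNReal.ofReal (iteratedDeriv m v t ^ 2) := by
    rw [← setLIntegral_Ioo_add, ← setLIntegral_Ioo_add]
    refine (setLIntegral_mono' measurableSet_Ioo fun s hs => ?_).trans (e1.trans_eq ?_)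
    · rw [min_eq_left (by linarith [hs.2]), add_sub_cancel_left]
    · simp only [iteratedDeriv_comp_const_add]
  have i2 : ∫⁻ t in Set.Ioo (b - L) b,
      ENNReal.ofReal (rayWeight m n D (min (t - a) (b - t)) * v t ^ 2) ≤
      ∫⁻ t in Set.Ioo (b - L) b, ENNReal.ofReal (iteratedDeriv m v t ^ 2) := by
    rw [← setLIntegral_Ioo_sub, ← setLIntegral_Ioo_sub]
    refine (setLIntegral_mono' measurableSet_Ioo fun s hs => ?_).trans (e2.trans_eq ?_)
    · rw [min_eq_right (by linarith [hs.2]), sub_sub_cancel]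
    · simp only [iteratedDeriv_comp_const_sub, smul_eq_mul, mul_pow, ← pow_mul, mul_comm m 2]
      simp
  have hmid : b - L = a + L := by rw [hL]; ring
  rw [hmid] at i2
  have hsplit : Set.Ioo a b =ᵐ[volume] (Set.Ioo a (a + L) ∪ Set.Ioo (a + L) b : Set ℝ) := by
    have : Set.Ioo a b = Set.Ioo a (a + L) ∪ Set.Ico (a + L) b :=
      (Set.Ioo_union_Ico_eq_Ioo (by linarith) (by linarith)).symm
    rw [this]
    exact (Filter.EventuallyEq.refl _ _).union Ioo_ae_eq_Ico.symm
  have hdisj : Disjoint (Set.Ioo a (a + L)) (Set.Ioo (a + L) b) :=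
    Set.disjoint_left.2 fun t h h' => lt_asymm h.2 h'.1
  rw [setLIntegral_congr hsplit, lintegral_union measurableSet_Ioo hdisj]
  refine (add_le_add i1 i2).trans ?_
  rw [← lintegral_union measurableSet_Ioo hdisj]
  exact setLIntegral_le_lintegral _ _

/-! ### Convex geometry: supporting half spaces, slabs and exit distances. -/

section Geometry

open scoped Pointwise

variable {N : ℕ} {Ω : Set (EuclideanSpace ℝ (Fin N))}

lemma frontier_nonempty (h0 : Ω.Nonempty) (h1 : Ω ≠ Set.univ) : (frontier Ω).Nonempty :=
  nonempty_frontier_iff.2 ⟨h0, h1⟩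

lemma le_bdist_of_ball_subset (hΩ : IsOpen Ω) (hf : (frontier Ω).Nonempty)
    {x : EuclideanSpace ℝ (Fin N)} {r : ℝ} (h : Metric.ball x r ⊆ Ω) : r ≤ bdist Ω x := by
  refine (Metric.le_infDist hf).2 fun y hy => ?_
  by_contra! hlt
  have : y ∈ Ω := h (by rwa [Metric.mem_ball, dist_comm])
  rw [hΩ.frontier_eq] at hy
  exact hy.2 this

lemma ball_bdist_subset (hΩ : IsOpen Ω) {x : EuclideanSpace ℝ (Fin N)} (hx : x ∈ Ω) :
    Metric.ball x (bdist Ω x) ⊆ Ω := by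
  rcases le_or_gt (bdist Ω x) 0 with h | h
  · rw [Metric.ball_eq_empty.2 h]; exact Set.empty_subset _
  refine (convex_ball x (bdist Ω x)).isPreconnected.subset_left_of_subset_union hΩ
    isClosed_closure.isOpen_compl (Set.disjoint_compl_right_iff_subset.2 subset_closure) ?_
    ⟨x, Metric.mem_ball_self h, hx⟩
  intro y hy
  by_cases hyΩ : y ∈ Ω
  · exact Or.inl hyΩ
  refine Or.inr fun hc => ?_
  have hyf : y ∈ frontier Ω := by rw [hΩ.frontier_eq]; exact ⟨hc, hyΩ⟩
  have := Metric.infDist_le_dist_of_mem (x := x) hyf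
  rw [dist_comm] at this
  exact absurd (Metric.mem_ball.1 hy) (not_lt.2 this)

lemma bdist_pos (hΩ : IsOpen Ω) (hf : (frontier Ω).Nonempty) {x : EuclideanSpace ℝ (Fin N)}
    (hx : x ∈ Ω) : 0 < bdist Ω x := by
  obtain ⟨ε, hε, h⟩ := Metric.isOpen_iff.1 hΩ x hx
  exact hε.trans_le (le_bdist_of_ball_subset hΩ hf h)

lemma continuous_bdist : Continuous (bdist Ω) := Metric.continuous_infDist_pt _

/-- A supporting half space at a nearest boundary point. -/
lemma exists_normal (hΩ : IsOpen Ω) (hc : Convex ℝ Ω) (hf : (frontier Ω).Nonempty)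
    {x : EuclideanSpace ℝ (Fin N)} (hx : x ∈ Ω) :
    ∃ e : EuclideanSpace ℝ (Fin N), ‖e‖ = 1 ∧
      ∀ z, x + z ∈ Ω → inner ℝ e z < bdist Ω x := by
  obtain ⟨p, hp, hpd⟩ := isClosed_frontier.exists_infDist_eq_dist hf x
  have hpΩ : p ∉ Ω := by
    rw [hΩ.frontier_eq] at hp; exact hp.2
  obtain ⟨f, hfp⟩ := geometric_hahn_banach_open_point hc hΩ hpΩ
  set g := (InnerProductSpace.toDual ℝ (EuclideanSpace ℝ (Fin N))).symm f with hg
  have hfg : ∀ z, f z = inner ℝ g z := fun z => by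
    rw [hg, InnerProductSpace.toDual_symm_apply]
  have hg0 : g ≠ 0 := by
    intro h
    have := hfp x hx
    rw [hfg, hfg, h, inner_zero_left, inner_zero_left] at this
    exact lt_irrefl _ this
  have hgn : 0 < ‖g‖ := norm_pos_iff.2 hg0
  refine ⟨‖g‖⁻¹ • g, by rw [norm_smul, norm_inv, norm_norm, inv_mul_cancel₀ hgn.ne'], ?_⟩
  intro z hz
  have h1 := hfp _ hz
  rw [hfg, hfg, inner_add_right] at h1
  have h2 : inner ℝ g (p - x) ≤ ‖g‖ * bdist Ω x := by
    refine (real_inner_le_norm _ _).trans_eq ?_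
    rw [bdist, hpd, dist_comm, dist_eq_norm]
  rw [inner_sub_right] at h2
  rw [real_inner_smul_left, inv_mul_lt_iff₀ hgn]
  linarith

/-- An open convex set that contains differences in all directions contains large balls. -/
lemma exists_ball_subset_of_sub_eq_univ (hN : 1 ≤ N) (hc : Convex ℝ Ω)
    (h : ∀ z : EuclideanSpace ℝ (Fin N), ∃ a ∈ Ω, ∃ b ∈ Ω, a - b = z) {r : ℝ} (hr : 0 < r) :
    ∃ x ∈ Ω, Metric.ball x r ⊆ Ω := by
  have hN0 : (0 : ℝ) < N := by exact_mod_cast hN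
  -- Take pairs `a i, b i` with difference `H e_i` and average their midpoints. Shifting the convex
  -- weights of the `i`-th pair by `N z_i / H` moves the average by `z_i e_i`; this `H` keeps the
  -- shift at most `1/2` for `|z_i| ≤ r`.
  set H : ℝ := 2 * N * r with hH
  have hH0 : 0 < H := by positivity
  choose a ha b hb hab using fun i : Fin N => h (H • EuclideanSpace.single i (1 : ℝ))
  set x := ∑ i, (N : ℝ)⁻¹ • ((1 / 2 : ℝ) • a i + (1 / 2 : ℝ) • b i) with hx
  have hball : Metric.ball x r ⊆ Ω := by
    intro y hy
    rw [Metric.mem_ball, dist_eq_norm] at hy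
    set z := y - x with hz
    have hzi : ∀ i, |z i| ≤ r := fun i => by
      have := PiLp.norm_apply_le z i
      rw [Real.norm_eq_abs] at this
      linarith
    have hy' : y = ∑ i, (N : ℝ)⁻¹ •
        ((1 / 2 + N * z i / H : ℝ) • a i + (1 / 2 - N * z i / H : ℝ) • b i) := by
      have e1 : ∀ i, (N : ℝ)⁻¹ • ((1 / 2 + N * z i / H : ℝ) • a i +
          (1 / 2 - N * z i / H : ℝ) • b i) =
          (N : ℝ)⁻¹ • ((1 / 2 : ℝ) • a i + (1 / 2 : ℝ) • b i) +
            z i • EuclideanSpace.single i (1 : ℝ) := fun i => by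
        have : z i • EuclideanSpace.single i (1 : ℝ) =
            ((N : ℝ)⁻¹ * (N * z i / H)) • (a i - b i) := by
          rw [hab, smul_smul]; congr 1; field_simp
        rw [this]
        module
      rw [Finset.sum_congr rfl fun i _ => e1 i, Finset.sum_add_distrib, ← hx]
      have e2 : ∑ i, z i • EuclideanSpace.single i (1 : ℝ) = z := by
        simpa using (EuclideanSpace.basisFun (Fin N) ℝ).sum_repr z
      rw [e2, hz]; abel
    rw [hy']
    refine hc.sum_mem (fun _ _ => by positivity) (by simp [hN0.ne']) fun i _ => ?_
    have hθ : |N * z i / H| ≤ 1 / 2 := by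
      rw [abs_div, abs_mul, abs_of_pos hN0, abs_of_pos hH0, div_le_iff₀ hH0, hH]
      have := mul_le_mul_of_nonneg_left (hzi i) hN0.le
      linarith
    have := abs_le.1 hθ
    exact hc (ha i) (hb i) (by linarith) (by linarith) (by ring)
  exact ⟨x, hball (Metric.mem_ball_self hr), hball⟩

/-- An open convex set with bounded distance function lies in a slab. -/
lemma exists_slab (hN : 1 ≤ N) (hΩ : IsOpen Ω) (h0 : Ω.Nonempty) (hc : Convex ℝ Ω)
    (h1 : Ω ≠ Set.univ) (hd : BddAbove (bdist Ω '' Ω)) :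
    ∃ (e : EuclideanSpace ℝ (Fin N)) (W : ℝ), ‖e‖ = 1 ∧ 0 < W ∧
      ∀ x ∈ Ω, ∀ y ∈ Ω, inner ℝ e (x - y) < W := by
  -- If `Ω - Ω` is everything, arbitrarily large balls contradict the bound on `d`; otherwise a
  -- missing point is separated from the convex open set `Ω - Ω`.
  by_cases hsub : ∀ z : EuclideanSpace ℝ (Fin N), ∃ a ∈ Ω, ∃ b ∈ Ω, a - b = z
  · obtain ⟨M, hM⟩ := hd
    obtain ⟨x, hx, hball⟩ := exists_ball_subset_of_sub_eq_univ hN hc hsub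
      (r := |M| + 1) (by positivity)
    have h2 := le_bdist_of_ball_subset hΩ (frontier_nonempty h0 h1) hball
    have h3 := hM ⟨x, hx, rfl⟩
    have := le_abs_self M
    linarith
  · push Not at hsub
    obtain ⟨p, hp⟩ := hsub
    have hpn : p ∉ Ω - Ω := by
      rintro ⟨a, ha, b, hb, hab⟩
      exact hp a ha b hb hab
    obtain ⟨f, hfp⟩ := geometric_hahn_banach_open_point (hc.sub hc) (hΩ.sub_left (s := Ω)) hpn
    set g := (InnerProductSpace.toDual ℝ (EuclideanSpace ℝ (Fin N))).symm f with hg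
    have hfg : ∀ z, f z = inner ℝ g z := fun z => by
      rw [hg, InnerProductSpace.toDual_symm_apply]
    obtain ⟨x, hx⟩ := h0
    have hpos : 0 < inner ℝ g p := by
      have := hfp (x - x) (Set.sub_mem_sub hx hx)
      rwa [sub_self, map_zero, hfg] at this
    have hg0 : g ≠ 0 := by
      rintro h
      rw [h, inner_zero_left] at hpos
      exact lt_irrefl _ hpos
    have hgn : 0 < ‖g‖ := norm_pos_iff.2 hg0
    refine ⟨‖g‖⁻¹ • g, ‖g‖⁻¹ * inner ℝ g p, by
      rw [norm_smul, norm_inv, norm_norm, inv_mul_cancel₀ hgn.ne'], by positivity, ?_⟩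
    intro x hx y hy
    have := hfp _ (Set.sub_mem_sub hx hy)
    rw [hfg, hfg] at this
    rw [real_inner_smul_left]
    exact mul_lt_mul_of_pos_left this (inv_pos.2 hgn)

/-- The distance from `x` to the complement of `Ω` along the line in direction `v`, in units
of `v`. -/
noncomputable def exitDist (Ω : Set (EuclideanSpace ℝ (Fin N)))
    (p : EuclideanSpace ℝ (Fin N) × EuclideanSpace ℝ (Fin N)) : ℝ :=
  Metric.infDist 0 {t : ℝ | p.1 + t • p.2 ∉ Ω}

/-- The extended exit distance is lower semicontinuous: a compact segment inside the open set `Ω`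
stays inside under small perturbations. -/
lemma measurable_exitDist (hΩ : IsOpen Ω) : Measurable (exitDist Ω) := by
  refine (LowerSemicontinuous.measurable (f := fun p : EuclideanSpace ℝ (Fin N) ×
    EuclideanSpace ℝ (Fin N) => Metric.infEDist 0 {t : ℝ | p.1 + t • p.2 ∉ Ω}) ?_).ennreal_toReal
  intro p c hc
  obtain ⟨r, hcr, hr⟩ := ENNReal.lt_iff_exists_nnreal_btwn.1 hc
  have hK : ∀ t ∈ Metric.closedBall (0 : ℝ) r, p.1 + t • p.2 ∈ Ω := fun t ht => by
    by_contra h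
    have h2 : Metric.infEDist 0 {t : ℝ | p.1 + t • p.2 ∉ Ω} ≤ edist 0 t :=
      Metric.infEDist_le_edist_of_mem h
    rw [edist_comm, edist_nndist] at h2
    have h3 : nndist t 0 ≤ r := ht
    exact absurd (hr.trans_le h2) (not_lt.2 (by exact_mod_cast h3))
  have hev := (isCompact_closedBall (0 : ℝ) r).eventually_forall_of_forall_eventually
    (x₀ := p) (P := fun (q : EuclideanSpace ℝ (Fin N) × EuclideanSpace ℝ (Fin N)) (t : ℝ) =>
      q.1 + t • q.2 ∈ Ω) fun t ht => by
    have hcont : Continuous fun z : (EuclideanSpace ℝ (Fin N) × EuclideanSpace ℝ (Fin N)) × ℝ =>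
      z.1.1 + z.2 • z.1.2 := by fun_prop
    exact hcont.continuousAt (x := (p, t)) |>.eventually_mem (hΩ.mem_nhds (hK t ht))
  filter_upwards [hev] with q hq
  refine hcr.trans_le (Metric.le_infEDist.2 fun t ht => ?_)
  by_contra! hlt
  refine ht (hq t ?_)
  rw [edist_comm, edist_nndist] at hlt
  have : nndist t 0 < r := by exact_mod_cast hlt
  exact this.le

/-- Convexity bounds the exit distance in terms of the distance to the boundary. -/
lemma abs_inner_mul_exitDist_le {x v e : EuclideanSpace ℝ (Fin N)}
    (he : ∀ z, x + z ∈ Ω → inner ℝ e z < bdist Ω x) :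
    |inner ℝ e v| * exitDist Ω (x, v) ≤ bdist Ω x := by
  have hd : 0 ≤ bdist Ω x := Metric.infDist_nonneg
  rcases eq_or_ne (inner ℝ e v) 0 with h | h
  · rw [h, abs_zero, zero_mul]; exact hd
  have hmem : bdist Ω x / inner ℝ e v ∈ {t : ℝ | x + t • v ∉ Ω} := fun hin => by
    have := he _ hin
    rw [real_inner_smul_right, div_mul_cancel₀ _ h] at this
    exact lt_irrefl _ this
  have h2 : exitDist Ω (x, v) ≤ dist 0 (bdist Ω x / inner ℝ e v) :=
    Metric.infDist_le_dist_of_mem hmem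
  rw [dist_zero_left, norm_div, Real.norm_eq_abs, Real.norm_eq_abs, abs_of_nonneg hd] at h2
  rw [mul_comm]
  exact (le_div_iff₀ (abs_pos.2 h)).1 h2

end Geometry

/-! ### Averages over lines and over the unit ball of directions. -/

section Averages

variable {N : ℕ}

lemma volume_setOf_sub_mul_mem_Icc {c : ℝ} (hc : 0 < c) (s : ℝ) :
    volume {t : ℝ | s - t * c ∈ Set.Icc (0 : ℝ) 1} = ENNReal.ofReal (1 / c) := by
  have : {t : ℝ | s - t * c ∈ Set.Icc (0 : ℝ) 1} = Set.Icc ((s - 1) / c) (s / c) := by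
    ext t
    simp only [Set.mem_ofPred_eq, Set.mem_Icc]
    rw [div_le_iff₀ hc, le_div_iff₀ hc]
    constructor <;> rintro ⟨h1, h2⟩ <;> constructor <;> linarith
  rw [this, Real.volume_Icc]
  congr 1
  field_simp
  ring

/-- Integration over the whole space as an average of integrals along lines of direction `v`. -/
lemma lintegral_line_average {f : EuclideanSpace ℝ (Fin N) → ENNReal} (hf : Measurable f)
    {v : EuclideanSpace ℝ (Fin N)} (hv : v ≠ 0) :
    ∫⁻ x in {x | inner ℝ v x ∈ Set.Icc (0 : ℝ) 1}, ∫⁻ t : ℝ, f (x + t • v) =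
      ENNReal.ofReal (1 / ‖v‖ ^ 2) * ∫⁻ x, f x := by
  set S : Set (EuclideanSpace ℝ (Fin N)) := {x | inner ℝ v x ∈ Set.Icc (0 : ℝ) 1} with hS
  have hSm : MeasurableSet S := measurableSet_Icc.preimage
    ((innerSL ℝ v).continuous.measurable)
  have hfm : Measurable fun p : EuclideanSpace ℝ (Fin N) × ℝ => f (p.1 + p.2 • v) :=
    hf.comp (by fun_prop)
  have hSm' : Measurable (S.indicator (1 : EuclideanSpace ℝ (Fin N) → ENNReal)) :=
    measurable_one.indicator hSm
  have hpm : Measurable fun p : EuclideanSpace ℝ (Fin N) × ℝ =>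
      S.indicator (1 : EuclideanSpace ℝ (Fin N) → ENNReal) (p.1 - p.2 • v) :=
    hSm'.comp (by fun_prop)
  calc ∫⁻ x in S, ∫⁻ t : ℝ, f (x + t • v)
      = ∫⁻ x, ∫⁻ t : ℝ, S.indicator 1 x * f (x + t • v) := by
        rw [← lintegral_indicator hSm]
        refine lintegral_congr fun x => ?_
        by_cases hx : x ∈ S <;> simp [hx]
    _ = ∫⁻ t : ℝ, ∫⁻ x, S.indicator 1 x * f (x + t • v) :=
        lintegral_lintegral_swap ((hSm'.comp measurable_fst).mul hfm).aemeasurable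
    _ = ∫⁻ t : ℝ, ∫⁻ x, S.indicator 1 (x - t • v) * f x := by
        refine lintegral_congr fun t => ?_
        rw [← lintegral_sub_right_eq_self _ (t • v)]
        simp only [sub_add_cancel]
    _ = ∫⁻ x, ∫⁻ t : ℝ, S.indicator 1 (x - t • v) * f x :=
        (lintegral_lintegral_swap (hpm.mul (hf.comp measurable_fst)).aemeasurable).symm
    _ = ∫⁻ x, ENNReal.ofReal (1 / ‖v‖ ^ 2) * f x := by
        refine lintegral_congr fun x => ?_
        have hxm : Measurable fun t : ℝ =>
            S.indicator (1 : EuclideanSpace ℝ (Fin N) → ENNReal) (x - t • v) :=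
          hSm'.comp (by fun_prop)
        rw [lintegral_mul_const _ hxm]
        congr 1
        have hv2 : 0 < ‖v‖ ^ 2 := by positivity
        -- After Fubini and translation, `x` is weighted by the time its line spends in the strip,
        -- which is `1 / ‖v‖²`.
        rw [← volume_setOf_sub_mul_mem_Icc hv2 (inner ℝ v x), ← lintegral_indicator_one]
        · refine lintegral_congr fun t => ?_
          simp only [Set.indicator_apply, hS, Set.mem_ofPred_eq, inner_sub_right,
            real_inner_smul_right, real_inner_self_eq_norm_sq, Pi.one_apply]
        · exact measurableSet_Icc.preimage (by fun_prop)
    _ = _ := lintegral_const_mul _ hf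

lemma lintegral_le_of_lines {f g : EuclideanSpace ℝ (Fin N) → ENNReal} (hf : Measurable f)
    (hg : Measurable g) {v : EuclideanSpace ℝ (Fin N)} (hv : v ≠ 0)
    (h : ∀ x, ∫⁻ t : ℝ, f (x + t • v) ≤ ∫⁻ t : ℝ, g (x + t • v)) :
    ∫⁻ x, f x ≤ ∫⁻ x, g x := by
  have h1 : ENNReal.ofReal (1 / ‖v‖ ^ 2) * ∫⁻ x, f x ≤
      ENNReal.ofReal (1 / ‖v‖ ^ 2) * ∫⁻ x, g x := by
    rw [← lintegral_line_average hf hv, ← lintegral_line_average hg hv]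
    exact lintegral_mono h
  have hpos : 0 < 1 / ‖v‖ ^ 2 := by positivity
  exact (ENNReal.mul_le_mul_iff_right (ENNReal.ofReal_pos.2 hpos).ne' ENNReal.ofReal_ne_top).1 h1

/-- Along lines of direction `e` this is the integrability of `log` on `(-1, 1]`. Only base points
in the ball of radius `3` contribute, so the line average is finite. -/
lemma integrableOn_log_inner {e : EuclideanSpace ℝ (Fin N)} (he : ‖e‖ = 1) :
    IntegrableOn (fun v => Real.log (inner ℝ e v)) (Metric.ball 0 1) := by
  have hm : Measurable fun v : EuclideanSpace ℝ (Fin N) => Real.log (inner ℝ e v) :=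
    Real.measurable_log.comp (innerSL ℝ e).continuous.measurable
  refine ⟨hm.aestronglyMeasurable, ?_⟩
  have he0 : e ≠ 0 := by rintro rfl; simp at he
  set f : EuclideanSpace ℝ (Fin N) → ENNReal :=
    (Metric.ball 0 1).indicator fun v => ‖Real.log (inner ℝ e v)‖ₑ with hf
  have hfm : Measurable f := hm.enorm.indicator Metric.isOpen_ball.measurableSet
  have hK : ∫⁻ t in Set.Ioc (-1 : ℝ) 1, ‖Real.log t‖ₑ < ⊤ :=
    (intervalIntegral.intervalIntegrable_log' (a := -1) (b := 1)).1.2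
  set K := ∫⁻ t in Set.Ioc (-1 : ℝ) 1, ‖Real.log t‖ₑ with hKdef
  have key : ∫⁻ x in {x | inner ℝ e x ∈ Set.Icc (0 : ℝ) 1}, ∫⁻ t : ℝ, f (x + t • e) ≤
      ∫⁻ _ in Metric.ball (0 : EuclideanSpace ℝ (Fin N)) 3, K := by
    have hSm : MeasurableSet {x : EuclideanSpace ℝ (Fin N) | inner ℝ e x ∈ Set.Icc (0 : ℝ) 1} :=
      measurableSet_Icc.preimage ((innerSL ℝ e).continuous.measurable)
    rw [← lintegral_indicator hSm, ← lintegral_indicator Metric.isOpen_ball.measurableSet]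
    refine lintegral_mono fun x => ?_
    refine Set.indicator_apply_le fun hx => ?_
    have hx' : 0 ≤ inner ℝ e x ∧ inner ℝ e x ≤ 1 := hx
    have hin : ∀ t : ℝ, inner ℝ e (x + t • e) = inner ℝ e x + t := fun t => by
      rw [inner_add_right, real_inner_smul_right, real_inner_self_eq_norm_sq, he]; ring
    have hbd : ∀ t : ℝ, x + t • e ∈ Metric.ball (0 : EuclideanSpace ℝ (Fin N)) 1 →
        -1 < inner ℝ e x + t ∧ inner ℝ e x + t < 1 := fun t ht => by
      rw [mem_ball_zero_iff] at ht
      have := (abs_real_inner_le_norm e (x + t • e))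
      rw [hin, he, one_mul] at this
      exact abs_lt.1 (this.trans_lt ht)
    by_cases hx3 : x ∈ Metric.ball (0 : EuclideanSpace ℝ (Fin N)) 3
    · rw [Set.indicator_of_mem hx3, hKdef, ← lintegral_indicator measurableSet_Ioc,
        ← lintegral_add_left_eq_self
          ((Set.Ioc (-1 : ℝ) 1).indicator fun t => ‖Real.log t‖ₑ) (inner ℝ e x)]
      refine lintegral_mono fun t => ?_
      by_cases ht : x + t • e ∈ Metric.ball (0 : EuclideanSpace ℝ (Fin N)) 1
      · have := hbd t ht
        have hft : f (x + t • e) = ‖Real.log (inner ℝ e (x + t • e))‖ₑ :=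
          Set.indicator_of_mem ht _
        rw [Set.indicator_of_mem (by exact ⟨this.1, this.2.le⟩), hft, hin]
      · have hft : f (x + t • e) = 0 := Set.indicator_of_notMem ht _
        rw [hft]
        exact zero_le
    · have : ∀ t : ℝ, f (x + t • e) = 0 := fun t => by
        refine Set.indicator_of_notMem (fun ht => hx3 ?_) _
        have h1 := hbd t ht
        have ht' := mem_ball_zero_iff.1 ht
        have h2 : ‖t • e‖ ≤ 2 := by
          rw [norm_smul, he, mul_one, Real.norm_eq_abs, abs_le]
          constructor <;> linarith [hx'.1, hx'.2]
        rw [mem_ball_zero_iff]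
        have h3 := norm_sub_le (x + t • e) (t • e)
        rw [add_sub_cancel_right] at h3
        linarith
      simp [this]
  rw [lintegral_line_average hfm he0, he, setLIntegral_const] at key
  simp only [one_pow, div_one, ENNReal.ofReal_one, one_mul] at key
  rw [HasFiniteIntegral, ← lintegral_indicator Metric.isOpen_ball.measurableSet]
  exact key.trans_lt (ENNReal.mul_lt_top hK measure_ball_lt_top)

/-- The moment `∫ ⟨ξ, v⟩^{2m} dv` over the unit ball. -/
noncomputable def ballMoment (m : ℕ) (ξ : EuclideanSpace ℝ (Fin N)) : ℝ :=
  ∫ v in Metric.ball 0 1, (inner ℝ ξ v) ^ (2 * m)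

lemma integrableOn_ball_of_continuous {f : EuclideanSpace ℝ (Fin N) → ℝ} (hf : Continuous f) :
    IntegrableOn f (Metric.ball 0 1) :=
  (hf.continuousOn.integrableOn_compact (isCompact_closedBall 0 1)).mono_set
    Metric.ball_subset_closedBall

/-- A reflection exchanging `ξ` and `η` preserves the ball and the measure. -/
lemma ballMoment_congr_norm (m : ℕ) {ξ η : EuclideanSpace ℝ (Fin N)} (h : ‖ξ‖ = ‖η‖) :
    ballMoment m ξ = ballMoment m η := by
  set R := (Submodule.span ℝ {ξ - η})ᗮ.reflection with hR
  have hRξ : R ξ = η := Submodule.reflection_sub h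
  have hmp : MeasurePreserving R := R.measurePreserving
  rw [ballMoment, ballMoment, ← hmp.setIntegral_preimage_emb R.toHomeomorph.measurableEmbedding
    fun v => (inner ℝ η v : ℝ) ^ (2 * m)]
  have hball : R ⁻¹' Metric.ball 0 1 = Metric.ball 0 1 := by
    ext v; simp
  rw [hball]
  refine integral_congr_ae (Filter.Eventually.of_forall fun v => ?_)
  simp only
  rw [← hRξ, R.inner_map_map]

lemma ballMoment_smul (m : ℕ) (c : ℝ) (ξ : EuclideanSpace ℝ (Fin N)) :
    ballMoment m (c • ξ) = c ^ (2 * m) * ballMoment m ξ := by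
  rw [ballMoment, ballMoment, ← integral_const_mul]
  simp only [real_inner_smul_left, mul_pow]

lemma ballMoment_eq (m : ℕ) {e : EuclideanSpace ℝ (Fin N)} (he : ‖e‖ = 1)
    (ξ : EuclideanSpace ℝ (Fin N)) : ballMoment m ξ = ‖ξ‖ ^ (2 * m) * ballMoment m e := by
  rw [← ballMoment_smul]
  exact ballMoment_congr_norm m (by rw [norm_smul, he, mul_one, norm_norm])

lemma ballMoment_pos (m : ℕ) {e : EuclideanSpace ℝ (Fin N)} (he : ‖e‖ = 1) :
    0 < ballMoment m e := by
  have hc : Continuous fun v : EuclideanSpace ℝ (Fin N) => (inner ℝ e v) ^ (2 * m) := by fun_prop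
  have hnn : ∀ v : EuclideanSpace ℝ (Fin N), 0 ≤ (inner ℝ e v : ℝ) ^ (2 * m) := fun v => by
    rw [pow_mul]; positivity
  rw [ballMoment, setIntegral_pos_iff_support_of_nonneg_ae
    (Filter.Eventually.of_forall hnn) (integrableOn_ball_of_continuous hc)]
  refine IsOpen.measure_pos _ (hc.isOpen_support.inter Metric.isOpen_ball)
    ⟨(1 / 2 : ℝ) • e, ?_, ?_⟩
  · rw [Function.mem_support, real_inner_smul_right, real_inner_self_eq_norm_sq, he]
    positivity
  · rw [mem_ball_zero_iff, norm_smul, he]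
    norm_num

lemma ae_inner_ne_zero {e : EuclideanSpace ℝ (Fin N)} (he : ‖e‖ = 1) :
    ∀ᵐ v : EuclideanSpace ℝ (Fin N), inner ℝ e v ≠ (0 : ℝ) := by
  have h := Measure.addHaar_submodule (volume : Measure (EuclideanSpace ℝ (Fin N)))
    (LinearMap.ker (innerSL ℝ e).toLinearMap) fun h => by
      have h1 : e ∈ LinearMap.ker (innerSL ℝ e).toLinearMap := h ▸ Submodule.mem_top
      rw [LinearMap.mem_ker] at h1
      have h2 : inner ℝ e e = (0 : ℝ) := h1
      rw [real_inner_self_eq_norm_sq, he] at h2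
      norm_num at h2
  rw [ae_iff]
  refine measure_mono_null (fun v hv => ?_) h
  simpa using hv

end Averages

/-! ### Plancherel identities for directional derivatives and Laplacians. -/

section Fourier

open scoped SchwartzMap FourierTransform LineDeriv Laplacian

variable {N : ℕ}

/-- A real valued Schwartz function regarded as a complex valued one. -/
noncomputable def complexify (f : 𝓢(EuclideanSpace ℝ (Fin N), ℝ)) :
    𝓢(EuclideanSpace ℝ (Fin N), ℂ) where
  toFun x := (f x : ℂ)
  smooth' := Complex.ofRealCLM.contDiff.comp (f.smooth ⊤)
  decay' k n := by
    obtain ⟨C, hC⟩ := f.decay' k n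
    refine ⟨C, fun x => ?_⟩
    have h := Complex.ofRealLI.norm_iteratedFDeriv_comp_left (f := f) (x := x) (i := n) (n := ∞)
      (f.smooth ⊤).contDiffAt (by exact_mod_cast le_top)
    exact (congrArg (‖x‖ ^ k * ·) h).le.trans (hC x)

lemma complexify_apply (f : 𝓢(EuclideanSpace ℝ (Fin N), ℝ)) (x : EuclideanSpace ℝ (Fin N)) :
    complexify f x = (f x : ℂ) := rfl

lemma complexify_lineDeriv (f : 𝓢(EuclideanSpace ℝ (Fin N), ℝ)) (v : EuclideanSpace ℝ (Fin N)) :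
    complexify (∂_{v} f) = ∂_{v} (complexify f) := by
  ext x
  rw [complexify_apply, SchwartzMap.lineDerivOp_apply_eq_fderiv,
    SchwartzMap.lineDerivOp_apply_eq_fderiv]
  have h : HasFDerivAt (complexify f) (Complex.ofRealCLM.comp (fderiv ℝ f x)) x :=
    Complex.ofRealCLM.hasFDerivAt.comp x (f.hasFDerivAt x)
  rw [h.fderiv]; rfl

lemma complexify_iterate_lineDeriv (f : 𝓢(EuclideanSpace ℝ (Fin N), ℝ))
    (v : EuclideanSpace ℝ (Fin N)) (m : ℕ) :
    complexify ((fun g : 𝓢(EuclideanSpace ℝ (Fin N), ℝ) => ∂_{v} g)^[m] f) =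
      (fun g : 𝓢(EuclideanSpace ℝ (Fin N), ℂ) => ∂_{v} g)^[m] (complexify f) := by
  induction m with
  | zero => rfl
  | succ m ih => rw [Function.iterate_succ_apply', Function.iterate_succ_apply', ← ih,
      complexify_lineDeriv]

lemma complexify_laplacian (f : 𝓢(EuclideanSpace ℝ (Fin N), ℝ)) :
    complexify (Δ f) = Δ (complexify f) := by
  rw [SchwartzMap.laplacian_eq_sum (EuclideanSpace.basisFun (Fin N) ℝ),
    SchwartzMap.laplacian_eq_sum (EuclideanSpace.basisFun (Fin N) ℝ)]
  ext x
  simp only [complexify_apply, sum_apply, ← complexify_lineDeriv, Complex.ofReal_sum]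

lemma complexify_iterate_laplacian (f : 𝓢(EuclideanSpace ℝ (Fin N), ℝ)) (k : ℕ) :
    complexify ((fun g : 𝓢(EuclideanSpace ℝ (Fin N), ℝ) => Δ g)^[k] f) =
      (fun g : 𝓢(EuclideanSpace ℝ (Fin N), ℂ) => Δ g)^[k] (complexify f) := by
  induction k with
  | zero => rfl
  | succ m ih => rw [Function.iterate_succ_apply', Function.iterate_succ_apply', ← ih,
      complexify_laplacian]

lemma fourier_lineDeriv_apply (f : 𝓢(EuclideanSpace ℝ (Fin N), ℂ))
    (v ξ : EuclideanSpace ℝ (Fin N)) :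
    𝓕 (∂_{v} f) ξ = (2 * Real.pi * Complex.I * (inner ℝ ξ v : ℝ)) * 𝓕 f ξ := by
  have hg : (fun x : EuclideanSpace ℝ (Fin N) => inner ℝ x v).HasTemperateGrowth :=
    ((innerSL ℝ).flip v).hasTemperateGrowth
  rw [SchwartzMap.fourier_lineDerivOp_eq, smul_apply,
    SchwartzMap.smulLeftCLM_apply_apply hg]
  simp only [smul_eq_mul, Complex.real_smul]
  ring

lemma fourier_iterate_lineDeriv_apply (f : 𝓢(EuclideanSpace ℝ (Fin N), ℂ))
    (v ξ : EuclideanSpace ℝ (Fin N)) (m : ℕ) :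
    𝓕 ((fun g : 𝓢(EuclideanSpace ℝ (Fin N), ℂ) => ∂_{v} g)^[m] f) ξ =
      (2 * Real.pi * Complex.I * (inner ℝ ξ v : ℝ)) ^ m * 𝓕 f ξ := by
  induction m with
  | zero => simp
  | succ m ih => rw [Function.iterate_succ_apply', fourier_lineDeriv_apply, ih]; ring

lemma fourier_laplacian_apply (f : 𝓢(EuclideanSpace ℝ (Fin N), ℂ))
    (ξ : EuclideanSpace ℝ (Fin N)) :
    𝓕 (Δ f) ξ = -((2 * Real.pi * ‖ξ‖ : ℝ) : ℂ) ^ 2 * 𝓕 f ξ := by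
  have hsum : 𝓕 (Δ f) = ∑ i, 𝓕 (∂_{EuclideanSpace.basisFun (Fin N) ℝ i}
      (∂_{EuclideanSpace.basisFun (Fin N) ℝ i} f)) := by
    rw [SchwartzMap.laplacian_eq_sum (EuclideanSpace.basisFun (Fin N) ℝ)]
    exact FourierTransform.fourier_sum _ _
  have hn : ((‖ξ‖ ^ 2 : ℝ) : ℂ) =
      ∑ i, ((inner ℝ ξ (EuclideanSpace.basisFun (Fin N) ℝ i) ^ 2 : ℝ) : ℂ) := by
    rw [← Complex.ofReal_sum, ← (EuclideanSpace.basisFun (Fin N) ℝ).sum_sq_norm_inner_left ξ]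
    simp only [Real.norm_eq_abs, sq_abs]
  rw [hsum, sum_apply]
  simp only [fourier_lineDeriv_apply]
  have : ((2 * Real.pi * ‖ξ‖ : ℝ) : ℂ) ^ 2 = (2 * Real.pi) ^ 2 * ((‖ξ‖ ^ 2 : ℝ) : ℂ) := by
    push_cast; ring
  rw [this, hn, Finset.mul_sum, ← Finset.sum_neg_distrib, Finset.sum_mul]
  refine Finset.sum_congr rfl fun i _ => ?_
  push_cast
  linear_combination (4 * (Real.pi : ℂ) ^ 2 *
    ((inner ℝ ξ (EuclideanSpace.basisFun (Fin N) ℝ i) : ℝ) : ℂ) ^ 2 * 𝓕 f ξ) * Complex.I_sq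

lemma fourier_iterate_laplacian_apply (f : 𝓢(EuclideanSpace ℝ (Fin N), ℂ))
    (ξ : EuclideanSpace ℝ (Fin N)) (k : ℕ) :
    𝓕 ((fun g : 𝓢(EuclideanSpace ℝ (Fin N), ℂ) => Δ g)^[k] f) ξ =
      (-((2 * Real.pi * ‖ξ‖ : ℝ) : ℂ) ^ 2) ^ k * 𝓕 f ξ := by
  induction k with
  | zero => simp
  | succ m ih => rw [Function.iterate_succ_apply', fourier_laplacian_apply, ih]; ring

lemma integrable_sq_norm (f : 𝓢(EuclideanSpace ℝ (Fin N), ℂ)) :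
    Integrable fun x => ‖f x‖ ^ 2 :=
  (memLp_two_iff_integrable_sq_norm f.continuous.aestronglyMeasurable).1 (f.memLp 2)

/-- The energy of order `m` on the Fourier side. -/
noncomputable def fourierEnergy (m : ℕ) (f : 𝓢(EuclideanSpace ℝ (Fin N), ℂ)) : ENNReal :=
  ∫⁻ ξ, ENNReal.ofReal ((2 * Real.pi * ‖ξ‖) ^ (2 * m) * ‖𝓕 f ξ‖ ^ 2)

lemma lintegral_sq_norm_fourier (f : 𝓢(EuclideanSpace ℝ (Fin N), ℂ)) :
    ∫⁻ x, ENNReal.ofReal (‖f x‖ ^ 2) = ∫⁻ ξ, ENNReal.ofReal (‖𝓕 f ξ‖ ^ 2) := by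
  rw [← ofReal_integral_eq_lintegral_ofReal (integrable_sq_norm f)
      (Filter.Eventually.of_forall fun _ => by positivity),
    ← ofReal_integral_eq_lintegral_ofReal (integrable_sq_norm (𝓕 f))
      (Filter.Eventually.of_forall fun _ => by positivity), SchwartzMap.integral_norm_sq_fourier]

/-- Averaging directional derivatives over the unit ball. -/
lemma lintegral_ball_lineDeriv (m : ℕ) (f : 𝓢(EuclideanSpace ℝ (Fin N), ℂ))
    {e : EuclideanSpace ℝ (Fin N)} (he : ‖e‖ = 1) :
    ∫⁻ v in Metric.ball (0 : EuclideanSpace ℝ (Fin N)) 1, ∫⁻ x, ENNReal.ofReal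
        (‖(fun g : 𝓢(EuclideanSpace ℝ (Fin N), ℂ) => ∂_{v} g)^[m] f x‖ ^ 2) =
      ENNReal.ofReal (ballMoment m e) * fourierEnergy m f := by
  have h1 : ∀ v ξ : EuclideanSpace ℝ (Fin N),
      ‖𝓕 ((fun g : 𝓢(EuclideanSpace ℝ (Fin N), ℂ) => ∂_{v} g)^[m] f) ξ‖ ^ 2 =
      (2 * Real.pi) ^ (2 * m) * ‖𝓕 f ξ‖ ^ 2 * (inner ℝ ξ v) ^ (2 * m) := fun v ξ => by
    rw [fourier_iterate_lineDeriv_apply, norm_mul, norm_pow, norm_mul, norm_mul, norm_mul,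
      Complex.norm_I, Complex.norm_real, Complex.norm_real, Complex.norm_ofNat, Real.norm_eq_abs,
      Real.norm_eq_abs, abs_of_pos Real.pi_pos, ← (even_two_mul m).pow_abs (inner ℝ ξ v : ℝ)]
    ring
  have hcont : Continuous fun p : EuclideanSpace ℝ (Fin N) × EuclideanSpace ℝ (Fin N) =>
      (2 * Real.pi) ^ (2 * m) * ‖𝓕 f p.2‖ ^ 2 * (inner ℝ p.2 p.1) ^ (2 * m) := by
    have := (𝓕 f).continuous
    fun_prop
  rw [lintegral_congr fun v => lintegral_sq_norm_fourier _]
  simp only [h1]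
  -- For fixed `ξ`, the average of `⟨ξ, v⟩^{2m}` is `‖ξ‖^{2m}` times the moment of a unit vector.
  rw [lintegral_lintegral_swap hcont.measurable.ennreal_ofReal.aemeasurable, fourierEnergy,
    ← lintegral_const_mul']
  · refine lintegral_congr fun ξ => ?_
    have hnn : 0 ≤ ballMoment m e := (ballMoment_pos m he).le
    rw [← ofReal_integral_eq_lintegral_ofReal, integral_const_mul, ← ENNReal.ofReal_mul hnn]
    · congr 1
      have := ballMoment_eq m he ξ
      rw [ballMoment] at this
      rw [this]
      ring
    · exact integrableOn_ball_of_continuous (by fun_prop)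
    · refine Filter.Eventually.of_forall fun v => ?_
      have := (even_two_mul m).pow_nonneg (inner ℝ ξ v : ℝ)
      simp only [Pi.zero_apply]
      positivity
  · exact ENNReal.ofReal_ne_top

lemma lintegral_iterate_laplacian (k : ℕ) (f : 𝓢(EuclideanSpace ℝ (Fin N), ℂ)) :
    ∫⁻ x, ENNReal.ofReal (‖(fun g : 𝓢(EuclideanSpace ℝ (Fin N), ℂ) => Δ g)^[k] f x‖ ^ 2) =
      fourierEnergy (2 * k) f := by
  rw [lintegral_sq_norm_fourier, fourierEnergy]
  refine lintegral_congr fun ξ => ?_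
  rw [fourier_iterate_laplacian_apply, norm_mul, norm_pow, norm_neg, norm_pow, Complex.norm_real,
    Real.norm_of_nonneg (by positivity)]
  generalize 2 * Real.pi * ‖ξ‖ = c
  congr 1
  ring

lemma lintegral_gradient_iterate_laplacian (k : ℕ) (f : 𝓢(EuclideanSpace ℝ (Fin N), ℂ)) :
    ∫⁻ x, ∑ i, ENNReal.ofReal (‖(∂_{EuclideanSpace.basisFun (Fin N) ℝ i}
        ((fun g : 𝓢(EuclideanSpace ℝ (Fin N), ℂ) => Δ g)^[k] f)) x‖ ^ 2) =
      fourierEnergy (2 * k + 1) f := by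
  have hm : ∀ g : 𝓢(EuclideanSpace ℝ (Fin N), ℂ),
      Measurable fun x => ENNReal.ofReal (‖g x‖ ^ 2) := fun g =>
    (g.continuous.norm.pow 2).measurable.ennreal_ofReal
  rw [lintegral_finsetSum _ fun i _ => hm _]
  rw [Finset.sum_congr rfl fun i _ => lintegral_sq_norm_fourier _]
  rw [← lintegral_finsetSum _ fun i _ => hm _, fourierEnergy]
  refine lintegral_congr fun ξ => ?_
  rw [← ENNReal.ofReal_sum_of_nonneg fun i _ => by positivity]
  congr 1
  have hn := (EuclideanSpace.basisFun (Fin N) ℝ).sum_sq_norm_inner_left ξ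
  simp only [fourier_lineDeriv_apply, fourier_iterate_laplacian_apply, norm_mul, norm_pow,
    norm_neg, Complex.norm_I, Complex.norm_real, Complex.norm_ofNat, norm_norm,
    Real.norm_of_nonneg Real.pi_pos.le, Real.norm_of_nonneg (zero_le_two (α := ℝ)), mul_pow]
  rw [← Finset.sum_mul, ← Finset.mul_sum, hn]
  simp only [← mul_pow]
  generalize 2 * Real.pi = c
  ring

end Fourier

/-! ### The energy on the Fourier side and as an average over directions. -/

section Energy

open scoped SchwartzMap FourierTransform LineDeriv Laplacian

variable {N : ℕ}

lemma iterLaplacian_coe (f : 𝓢(EuclideanSpace ℝ (Fin N), ℝ)) (k : ℕ) :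
    iterLaplacian k f = (fun g : 𝓢(EuclideanSpace ℝ (Fin N), ℝ) => Δ g)^[k] f := by
  induction k with
  | zero => rfl
  | succ k ih =>
    rw [Function.iterate_succ_apply', iterLaplacian, Function.iterate_succ_apply']
    rw [iterLaplacian] at ih
    rw [ih]
    ext x
    exact (SchwartzMap.laplacian_apply _ x).symm

/-- Locality of the Laplacian lets integrals over `Ω` become integrals over the whole space, where
Plancherel applies. -/
lemma iterLaplacian_eventuallyEq_zero {u : EuclideanSpace ℝ (Fin N) → ℝ}
    {x : EuclideanSpace ℝ (Fin N)} (hx : x ∉ tsupport u) (k : ℕ) :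
    iterLaplacian k u =ᶠ[nhds x] 0 := by
  induction k with
  | zero => exact notMem_tsupport_iff_eventuallyEq.1 hx
  | succ k ih =>
    rw [iterLaplacian, Function.iterate_succ_apply']
    refine (InnerProductSpace.laplacian_congr_nhds ih).trans ?_
    have : (0 : EuclideanSpace ℝ (Fin N) → ℝ) = fun _ => 0 := rfl
    rw [this, InnerProductSpace.laplacian_const]
    rfl

lemma setIntegral_iterLaplacian {u : EuclideanSpace ℝ (Fin N) → ℝ}
    {Ω : Set (EuclideanSpace ℝ (Fin N))} (hu : tsupport u ⊆ Ω) (k : ℕ) :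
    ∫ x in Ω, iterLaplacian k u x ^ 2 = ∫ x, iterLaplacian k u x ^ 2 := by
  refine setIntegral_eq_integral_of_forall_compl_eq_zero fun x hx => ?_
  rw [(iterLaplacian_eventuallyEq_zero (fun h => hx (hu h)) k).eq_of_nhds]
  simp

lemma setIntegral_gradient_iterLaplacian {u : EuclideanSpace ℝ (Fin N) → ℝ}
    {Ω : Set (EuclideanSpace ℝ (Fin N))} (hu : tsupport u ⊆ Ω) (k : ℕ) :
    ∫ x in Ω, ‖gradient (iterLaplacian k u) x‖ ^ 2 =
      ∫ x, ‖gradient (iterLaplacian k u) x‖ ^ 2 := by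
  refine setIntegral_eq_integral_of_forall_compl_eq_zero fun x hx => ?_
  rw [gradient, (iterLaplacian_eventuallyEq_zero (fun h => hx (hu h)) k).fderiv_eq]
  simp

lemma norm_gradient_sq (f : 𝓢(EuclideanSpace ℝ (Fin N), ℝ)) (x : EuclideanSpace ℝ (Fin N)) :
    ‖gradient f x‖ ^ 2 =
      ∑ i, ‖complexify (∂_{EuclideanSpace.basisFun (Fin N) ℝ i} f) x‖ ^ 2 := by
  rw [← (EuclideanSpace.basisFun (Fin N) ℝ).sum_sq_norm_inner_left (gradient f x)]
  refine Finset.sum_congr rfl fun i _ => ?_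
  rw [gradient, InnerProductSpace.toDual_symm_apply, complexify_apply,
    SchwartzMap.lineDerivOp_apply_eq_fderiv, Complex.norm_real]

lemma ofReal_energy (m : ℕ) (f : 𝓢(EuclideanSpace ℝ (Fin N), ℝ))
    {Ω : Set (EuclideanSpace ℝ (Fin N))} (hf : tsupport f ⊆ Ω) :
    ENNReal.ofReal (energy m Ω f) = fourierEnergy m (complexify f) := by
  rw [energy]
  split_ifs with hm
  · obtain ⟨k, hk⟩ := hm
    have hk' : m / 2 = k := by omega
    rw [hk', setIntegral_iterLaplacian hf, iterLaplacian_coe]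
    have e : ∀ x, ((fun g : 𝓢(EuclideanSpace ℝ (Fin N), ℝ) => Δ g)^[k] f) x ^ 2 =
        ‖((fun g : 𝓢(EuclideanSpace ℝ (Fin N), ℂ) => Δ g)^[k] (complexify f)) x‖ ^ 2 := fun x => by
      rw [← complexify_iterate_laplacian, complexify_apply, Complex.norm_real, Real.norm_eq_abs,
        sq_abs]
    simp only [e]
    rw [ofReal_integral_eq_lintegral_ofReal (integrable_sq_norm _)
      (Filter.Eventually.of_forall fun _ => by positivity), lintegral_iterate_laplacian,
      show 2 * k = m by omega]
  · obtain ⟨k, hk⟩ := Nat.not_even_iff_odd.1 hm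
    have hk' : (m - 1) / 2 = k := by omega
    rw [hk', setIntegral_gradient_iterLaplacian hf, iterLaplacian_coe]
    simp only [norm_gradient_sq, complexify_lineDeriv, complexify_iterate_laplacian]
    rw [ofReal_integral_eq_lintegral_ofReal
      (integrable_finsetSum _ fun i _ => integrable_sq_norm _)
      (Filter.Eventually.of_forall fun _ => by positivity), hk,
      ← lintegral_gradient_iterate_laplacian]
    refine lintegral_congr fun x => ?_
    rw [← ENNReal.ofReal_sum_of_nonneg fun i _ => by positivity]

lemma iteratedDeriv_line (f : 𝓢(EuclideanSpace ℝ (Fin N), ℝ)) (v x : EuclideanSpace ℝ (Fin N))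
    (m : ℕ) : iteratedDeriv m (fun t : ℝ => f (x + t • v)) =
      fun t => ((fun g : 𝓢(EuclideanSpace ℝ (Fin N), ℝ) => ∂_{v} g)^[m] f) (x + t • v) := by
  induction m with
  | zero => simp
  | succ m ih =>
    rw [iteratedDeriv_succ, ih]
    ext t
    rw [Function.iterate_succ_apply', SchwartzMap.lineDerivOp_apply_eq_fderiv]
    have h1 : HasDerivAt (fun t : ℝ => x + t • v) v t := by
      simpa using ((hasDerivAt_id t).smul_const v).const_add x
    exact (((SchwartzMap.hasFDerivAt _ (x + t • v)).comp_hasDerivAt t h1)).deriv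

/-- The energy as an average of squared directional derivatives. -/
lemma lintegral_ball_iterate_lineDeriv (m : ℕ) (f : 𝓢(EuclideanSpace ℝ (Fin N), ℝ))
    {Ω : Set (EuclideanSpace ℝ (Fin N))} (hf : tsupport f ⊆ Ω)
    {e : EuclideanSpace ℝ (Fin N)} (he : ‖e‖ = 1) :
    ∫⁻ v in Metric.ball (0 : EuclideanSpace ℝ (Fin N)) 1, ∫⁻ x, ENNReal.ofReal
        (((fun g : 𝓢(EuclideanSpace ℝ (Fin N), ℝ) => ∂_{v} g)^[m] f) x ^ 2) =
      ENNReal.ofReal (ballMoment m e) * ENNReal.ofReal (energy m Ω f) := by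
  rw [ofReal_energy m f hf, ← lintegral_ball_lineDeriv m _ he]
  refine lintegral_congr fun v => lintegral_congr fun x => ?_
  rw [← complexify_iterate_lineDeriv, complexify_apply, Complex.norm_real, Real.norm_eq_abs,
    sq_abs]

end Energy

/-! ### The one-dimensional inequality on slices of `Ω`. -/

section Lines

open scoped SchwartzMap LineDeriv

variable {N : ℕ} {Ω : Set (EuclideanSpace ℝ (Fin N))}

lemma eq_Ioo_of_isOpen_convex {I : Set ℝ} (ho : IsOpen I) (hc : Convex ℝ I) (hne : I.Nonempty)
    (hb : BddBelow I) (ha : BddAbove I) : I = Set.Ioo (sInf I) (sSup I) := by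
  refine Set.Subset.antisymm (fun t ht => ?_)
    (IsConnected.Ioo_csInf_csSup_subset ⟨hne, hc.isPreconnected⟩ hb ha)
  obtain ⟨ε, hε, hball⟩ := Metric.isOpen_iff.1 ho t ht
  have h1 : t - ε / 2 ∈ I := hball (by
    rw [Metric.mem_ball, Real.dist_eq, sub_sub_cancel_left, abs_neg, abs_of_pos (by linarith)]
    linarith)
  have h2 : t + ε / 2 ∈ I := hball (by
    rw [Metric.mem_ball, Real.dist_eq, add_sub_cancel_left, abs_of_pos (by linarith)]
    linarith)
  have h3 := csInf_le hb h1
  have h4 := le_csSup ha h2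
  constructor <;> linarith

/-- The slices of a convex set in a slab are bounded intervals. -/
lemma exists_line_eq_Ioo (hΩ : IsOpen Ω) (hc : Convex ℝ Ω) {e : EuclideanSpace ℝ (Fin N)} {W : ℝ}
    (hslab : ∀ x ∈ Ω, ∀ y ∈ Ω, inner ℝ e (x - y) < W) {v : EuclideanSpace ℝ (Fin N)}
    (hv : inner ℝ e v ≠ (0 : ℝ)) (x : EuclideanSpace ℝ (Fin N))
    (hne : {t : ℝ | x + t • v ∈ Ω}.Nonempty) :
    ∃ a b : ℝ, a < b ∧ b - a ≤ W / |inner ℝ e v| ∧ {t : ℝ | x + t • v ∈ Ω} = Set.Ioo a b := by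
  set I : Set ℝ := {t : ℝ | x + t • v ∈ Ω} with hI
  have hv0 : 0 < |(inner ℝ e v : ℝ)| := abs_pos.2 hv
  have hd : ∀ s ∈ I, ∀ t ∈ I, s - t ≤ W / |inner ℝ e v| := fun s hs t ht => by
    rw [le_div_iff₀ hv0]
    have h1 := hslab _ hs _ ht
    have h2 := hslab _ ht _ hs
    rw [add_sub_add_left_eq_sub, ← sub_smul, real_inner_smul_right] at h1 h2
    rcases abs_cases (inner ℝ e v : ℝ) with h | h <;> rw [h.1] <;> linarith
  obtain ⟨t₀, ht₀⟩ := hne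
  have ho : IsOpen I := hΩ.preimage (by fun_prop : Continuous fun t : ℝ => x + t • v)
  have hcI : Convex ℝ I := by
    intro s hs t ht a b ha hb hab
    have := hc hs ht ha hb hab
    have e1 : a • (x + s • v) + b • (x + t • v) = x + (a • s + b • t) • v := by
      have : x = (a + b) • x := by rw [hab, one_smul]
      nth_rewrite 3 [this]
      simp only [smul_eq_mul]
      module
    rw [e1] at this
    exact this
  have hba : BddAbove I := ⟨t₀ + W / |inner ℝ e v|, fun s hs => by
    have := hd s hs t₀ ht₀; linarith⟩
  have hbb : BddBelow I := ⟨t₀ - W / |inner ℝ e v|, fun s hs => by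
    have := hd t₀ ht₀ s hs; linarith⟩
  have heq := eq_Ioo_of_isOpen_convex ho hcI ⟨t₀, ht₀⟩ hbb hba
  have hlt : t₀ ∈ Set.Ioo (sInf I) (sSup I) := heq ▸ ht₀
  refine ⟨sInf I, sSup I, hlt.1.trans hlt.2, ?_, heq⟩
  have : sSup I - W / |inner ℝ e v| ≤ sInf I := by
    refine le_csInf ⟨t₀, ht₀⟩ fun t ht => ?_
    have : sSup I ≤ t + W / |inner ℝ e v| :=
      csSup_le ⟨t₀, ht₀⟩ fun s hs => by have := hd s hs t ht; linarith
    linarith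
  linarith

lemma bdist_le_abs_of_notMem (hΩ : IsOpen Ω) {x v : EuclideanSpace ℝ (Fin N)} (hx : x ∈ Ω)
    (hv : ‖v‖ ≤ 1) {s : ℝ} (hs : x + s • v ∉ Ω) : bdist Ω x ≤ |s| := by
  by_contra! hlt
  refine hs (ball_bdist_subset hΩ hx ?_)
  rw [Metric.mem_ball, dist_eq_norm, add_sub_cancel_left, norm_smul, Real.norm_eq_abs]
  nlinarith [abs_nonneg s]

/-- The weight in direction `v`, with the logarithmic factors evaluated at `c ⟨e, v⟩ d(x)`. -/
noncomputable def lineWeight (Ω : Set (EuclideanSpace ℝ (Fin N))) (m n : ℕ) (c : ℝ)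
    (e x v : EuclideanSpace ℝ (Fin N)) : ℝ :=
  (A m + B m * weightSum n (bdist Ω x * (c * |inner ℝ e v|))) / exitDist Ω (x, v) ^ (2 * m)

lemma measurable_lineWeight (hΩ : IsOpen Ω) (m n : ℕ) (c : ℝ) (e : EuclideanSpace ℝ (Fin N)) :
    Measurable fun p : EuclideanSpace ℝ (Fin N) × EuclideanSpace ℝ (Fin N) =>
      lineWeight Ω m n c e p.1 p.2 := by
  have h1 : Measurable fun p : EuclideanSpace ℝ (Fin N) × EuclideanSpace ℝ (Fin N) =>
      bdist Ω p.1 * (c * |inner ℝ e p.2|) := by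
    have := (continuous_bdist (Ω := Ω)).comp
      (continuous_fst (X := EuclideanSpace ℝ (Fin N)) (Y := EuclideanSpace ℝ (Fin N)))
    exact (this.mul (by fun_prop)).measurable
  exact (measurable_const.add (((measurable_weightSum n).comp h1).const_mul _)).div
    ((measurable_exitDist hΩ).pow_const _)

/-- The directional inequality along a single line. -/
lemma lintegral_line_le (m : ℕ) :
    ∃ δ : ℝ, 0 < δ ∧ δ < 1 ∧ ∀ (n : ℕ) {N : ℕ} {Ω : Set (EuclideanSpace ℝ (Fin N))}
      (_ : IsOpen Ω) (_ : Convex ℝ Ω) (_ : (frontier Ω).Nonempty)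
      {e : EuclideanSpace ℝ (Fin N)} {W : ℝ} (_ : 0 < W)
      (_ : ∀ x ∈ Ω, ∀ y ∈ Ω, inner ℝ e (x - y) < W) (f : 𝓢(EuclideanSpace ℝ (Fin N), ℝ))
      (_ : HasCompactSupport f) (_ : tsupport f ⊆ Ω) (v : EuclideanSpace ℝ (Fin N))
      (_ : inner ℝ e v ≠ (0 : ℝ)) (_ : ‖v‖ ≤ 1) (x : EuclideanSpace ℝ (Fin N)),
      ∫⁻ t : ℝ, ENNReal.ofReal (lineWeight Ω m n (δ / W) e (x + t • v) v * f (x + t • v) ^ 2) ≤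
        ∫⁻ t : ℝ, ENNReal.ofReal
          (((fun g : 𝓢(EuclideanSpace ℝ (Fin N), ℝ) => ∂_{v} g)^[m] f) (x + t • v) ^ 2) := by
  obtain ⟨δ, hδ0, hδ1, H⟩ := rellich_interval m
  refine ⟨δ, hδ0, hδ1, ?_⟩
  intro n N Ω hΩ hc hf e W hW hslab f hfc hfs v hv hv1 x
  have hzero : ∀ t : ℝ, x + t • v ∉ Ω → f (x + t • v) = 0 := fun t ht =>
    image_eq_zero_of_notMem_tsupport fun h => ht (hfs h)
  by_cases hne : {t : ℝ | x + t • v ∈ Ω}.Nonempty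
  swap
  · have : ∀ t : ℝ, f (x + t • v) = 0 := fun t => hzero t fun h => hne ⟨t, h⟩
    simp [this]
  obtain ⟨a, b, hab, hW', hI⟩ := exists_line_eq_Ioo hΩ hc hslab hv x hne
  have hmem : ∀ t, x + t • v ∈ Ω ↔ t ∈ Set.Ioo a b := fun t => by rw [← hI]; rfl
  have hv0 : 0 < |(inner ℝ e v : ℝ)| := abs_pos.2 hv
  -- The smallest `D` allowed by the length bound for slices; it depends on `v`, hence the factor
  -- `⟨e, v⟩` in `lineWeight`.
  set D : ℝ := W / (δ * |inner ℝ e v|) with hD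
  have hD0 : 0 < D := by positivity
  have hδD : δ * D = W / |inner ℝ e v| := by rw [hD]; field_simp
  have hcont : Continuous fun t : ℝ => x + t • v := by fun_prop
  have hsupp : tsupport (fun t : ℝ => f (x + t • v)) ⊆ (fun t : ℝ => x + t • v) ⁻¹' tsupport f :=
    tsupport_comp_subset_preimage f hcont
  have hsupp' : tsupport (fun t : ℝ => f (x + t • v)) ⊆ Set.Ioo a b := fun t ht =>
    (hmem t).1 (hfs (hsupp ht))
  have hcs : HasCompactSupport fun t : ℝ => f (x + t • v) :=
    isCompact_Icc.of_isClosed_subset (isClosed_tsupport _) (hsupp'.trans Set.Ioo_subset_Icc_self)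
  have hmain := H n D a b (fun t => f (x + t • v)) hD0 hab (hW'.trans_eq hδD.symm)
    ((f.smooth ⊤).comp (by fun_prop)) hcs hsupp'
  rw [iteratedDeriv_line] at hmain
  refine le_trans ?_ hmain
  rw [← lintegral_indicator measurableSet_Ioo]
  refine lintegral_mono fun t => ?_
  by_cases ht : t ∈ Set.Ioo a b
  swap
  · simp [hzero t fun h => ht ((hmem t).1 h)]
  rw [Set.indicator_of_mem ht]
  refine ENNReal.ofReal_le_ofReal (mul_le_mul_of_nonneg_right ?_ (sq_nonneg _))
  have hy := (hmem t).2 ht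
  have hout : ∀ s : ℝ, t + s ∉ Set.Ioo a b → (x + t • v) + s • v ∉ Ω := fun s hs h => by
    rw [add_assoc, ← add_smul] at h
    exact hs ((hmem _).1 h)
  set ρ := min (t - a) (b - t) with hρ
  have hρ0 : 0 < ρ := lt_min (by linarith [ht.1]) (by linarith [ht.2])
  have hρe : ρ ≤ exitDist Ω (x + t • v, v) := by
    refine (Metric.le_infDist ⟨a - t, hout _ (by simp)⟩).2 fun s hs => ?_
    have hs' : t + s ∉ Set.Ioo a b := fun h => hs (by
      have := (hmem _).2 h
      rwa [add_smul, ← add_assoc] at this)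
    rw [dist_zero_left, Real.norm_eq_abs]
    by_contra! hlt
    have h1 := hlt.trans_le (min_le_left _ _)
    have h2 := hlt.trans_le (min_le_right _ _)
    rw [abs_lt] at h1 h2
    exact hs' ⟨by linarith [h1.1], by linarith [h2.2]⟩
  -- The log weights increase in their argument, so `ρ` may be lowered to `d`, while the power keeps
  -- the exit distance.
  have hbρ : bdist Ω (x + t • v) ≤ ρ := by
    refine le_min ?_ ?_
    · have := bdist_le_abs_of_notMem hΩ hy hv1 (hout (a - t) (by simp))
      rwa [abs_of_neg (by linarith [ht.1]), neg_sub] at this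
    · have := bdist_le_abs_of_notMem hΩ hy hv1 (hout (b - t) (by simp))
      rwa [abs_of_pos (by linarith [ht.2])] at this
  have hb0 := bdist_pos hΩ hf hy
  have hρD : ρ / D ≤ 1 := by
    rw [div_le_one hD0]
    have h1 : ρ ≤ t - a := min_le_left _ _
    have h2 : b - a ≤ δ * D := hW'.trans_eq hδD.symm
    nlinarith [ht.2]
  have harg : bdist Ω (x + t • v) * (δ / W * |inner ℝ e v|) = bdist Ω (x + t • v) / D := by
    rw [hD]; field_simp
  have hA := A_pos m
  have hB := B_nonneg m
  have hS := weightSum_nonneg n (ρ / D)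
  rw [lineWeight, rayWeight, harg]
  refine div_le_div₀ (by positivity) ?_ (by positivity) (pow_le_pow_left₀ hρ0.le hρe _)
  have := weightSum_le (div_pos hb0 hD0) (div_le_div_of_nonneg_right hbρ hD0.le) hρD n
  gcongr

end Lines

/-! ### Averaging the weights, the choice of `D`, and the conclusion. -/

section Main

open scoped SchwartzMap LineDeriv

variable {N : ℕ} {Ω : Set (EuclideanSpace ℝ (Fin N))}

lemma ofReal_integral_le_lintegral {α : Type*} [MeasurableSpace α] {μ : Measure α} {g : α → ℝ}
    (hg : Integrable g μ) : ENNReal.ofReal (∫ a, g a ∂μ) ≤ ∫⁻ a, ENNReal.ofReal (g a) ∂μ := by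
  rw [integral_eq_lintegral_pos_part_sub_lintegral_neg_part hg]
  refine le_trans (ENNReal.ofReal_le_ofReal ?_) ENNReal.ofReal_toReal_le
  exact sub_le_self _ ENNReal.toReal_nonneg

lemma bdist_le_of_slab (hΩ : IsOpen Ω) {e : EuclideanSpace ℝ (Fin N)} {W : ℝ} (he : ‖e‖ = 1)
    (hW : 0 < W) (hslab : ∀ x ∈ Ω, ∀ y ∈ Ω, inner ℝ e (x - y) < W)
    {x : EuclideanSpace ℝ (Fin N)} (hx : x ∈ Ω) : bdist Ω x ≤ W := by
  by_contra! hlt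
  have h1 : x + W • e ∈ Ω := ball_bdist_subset hΩ hx (by
    rw [Metric.mem_ball, dist_eq_norm, add_sub_cancel_left, norm_smul, he, mul_one,
      Real.norm_of_nonneg hW.le]
    exact hlt)
  have h2 := hslab _ h1 _ hx
  rw [add_sub_cancel_left, real_inner_smul_right, real_inner_self_eq_norm_sq, he] at h2
  linarith

/-- Averaging the directional weights over the unit ball; convexity of the logarithmic weights in
the logarithm of their argument gives the Jensen type bound. -/
lemma ofReal_le_lintegral_lineWeight (hΩ : IsOpen Ω) (hc : Convex ℝ Ω)
    (hf : (frontier Ω).Nonempty) {e : EuclideanSpace ℝ (Fin N)} {W δ : ℝ} (he : ‖e‖ = 1)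
    (hW : 0 < W) (hδ0 : 0 < δ) (hδ1 : δ < 1)
    (hslab : ∀ x ∈ Ω, ∀ y ∈ Ω, inner ℝ e (x - y) < W) (m n : ℕ) {D : ℝ} (hD0 : 0 < D)
    (hD : ∫ v in Metric.ball (0 : EuclideanSpace ℝ (Fin N)) 1, |Real.log (inner ℝ e v)| ≤
      ballMoment m e * Real.log (δ / W * D))
    {x : EuclideanSpace ℝ (Fin N)} (hx : x ∈ Ω) (hxD : bdist Ω x ≤ D) :
    ENNReal.ofReal (ballMoment m e *
        ((A m + B m * weightSum n (bdist Ω x / D)) / bdist Ω x ^ (2 * m))) ≤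
      ∫⁻ v in Metric.ball (0 : EuclideanSpace ℝ (Fin N)) 1,
        ENNReal.ofReal (lineWeight Ω m n (δ / W) e x v) := by
  obtain ⟨e', he', hnormal⟩ := exists_normal hΩ hc hf hx
  set d := bdist Ω x with hd
  have hd0 : 0 < d := bdist_pos hΩ hf hx
  have hdW : d ≤ W := bdist_le_of_slab hΩ he hW hslab hx
  set c := δ / W with hcdef
  have hc0 : 0 < c := by positivity
  have hdc : d * c ≤ 1 := by
    rw [hcdef, ← mul_div_assoc, div_le_one hW]
    nlinarith
  set s := d / D with hs
  have hs0 : 0 < s := by positivity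
  have hs1 : s ≤ 1 := (div_le_one hD0).2 hxD
  have hA := A_pos m
  have hB := B_nonneg m
  set S := weightSum n s with hS
  set R := weightSlope n s with hR
  have hR0 : 0 ≤ R := weightSlope_nonneg hs0 hs1 n
  -- The minorant of the directional weight: the tangent line in `log s` at `s = d / D`, with the
  -- exit distance replaced by `d / |⟨e', v⟩|`. Here `e` is the slab normal and `e'` the normal
  -- belonging to `x`.
  let J : EuclideanSpace ℝ (Fin N) → ℝ := fun v =>
    ((A m + B m * S + B m * R * Real.log (c * D)) * (inner ℝ e' v) ^ (2 * m) +
      B m * R * ((inner ℝ e' v) ^ (2 * m) * Real.log (inner ℝ e v))) / d ^ (2 * m)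
  have hlogi := integrableOn_log_inner he
  have hpow1 : ∀ v ∈ Metric.ball (0 : EuclideanSpace ℝ (Fin N)) 1,
      0 ≤ (inner ℝ e' v : ℝ) ^ (2 * m) ∧ (inner ℝ e' v : ℝ) ^ (2 * m) ≤ 1 := fun v hv => by
    refine ⟨(even_two_mul m).pow_nonneg _, ?_⟩
    rw [← (even_two_mul m).pow_abs]
    refine pow_le_one₀ (abs_nonneg _) ((abs_real_inner_le_norm _ _).trans ?_)
    rw [he', one_mul]
    exact (mem_ball_zero_iff.1 hv).le
  have hlogi' : IntegrableOn (fun v => (inner ℝ e' v : ℝ) ^ (2 * m) * Real.log (inner ℝ e v))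
      (Metric.ball (0 : EuclideanSpace ℝ (Fin N)) 1) := by
    refine Integrable.bdd_mul (c := 1) hlogi (by fun_prop) ?_
    refine (ae_restrict_mem Metric.isOpen_ball.measurableSet).mono fun v hv => ?_
    rw [Real.norm_of_nonneg (hpow1 v hv).1]
    exact (hpow1 v hv).2
  have hpi : IntegrableOn (fun v => (inner ℝ e' v : ℝ) ^ (2 * m))
      (Metric.ball (0 : EuclideanSpace ℝ (Fin N)) 1) :=
    integrableOn_ball_of_continuous (by fun_prop)
  have hJi : IntegrableOn J (Metric.ball (0 : EuclideanSpace ℝ (Fin N)) 1) :=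
    ((hpi.const_mul _).add (hlogi'.const_mul _)).div_const _
  have hJ : ballMoment m e * ((A m + B m * S) / d ^ (2 * m)) ≤
      ∫ v in Metric.ball (0 : EuclideanSpace ℝ (Fin N)) 1, J v := by
    have hM : ∫ v in Metric.ball (0 : EuclideanSpace ℝ (Fin N)) 1,
        (inner ℝ e' v : ℝ) ^ (2 * m) = ballMoment m e :=
      ballMoment_congr_norm m (he'.trans he.symm)
    -- Bounding `⟨e', v⟩^{2m}` by one removes the dependence on `x`, so a single `D` works at every
    -- point.
    have hlow : -(ballMoment m e * Real.log (c * D)) ≤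
        ∫ v in Metric.ball (0 : EuclideanSpace ℝ (Fin N)) 1,
          (inner ℝ e' v : ℝ) ^ (2 * m) * Real.log (inner ℝ e v) := by
      refine (neg_le_neg hD).trans ?_
      rw [← integral_neg]
      refine setIntegral_mono_on hlogi.abs.neg hlogi' Metric.isOpen_ball.measurableSet
        fun v hv => ?_
      have h1 := hpow1 v hv
      have h2 := neg_abs_le (Real.log (inner ℝ e v))
      have h3 := abs_nonneg (Real.log (inner ℝ e v))
      nlinarith [mul_le_mul_of_nonneg_left h2 h1.1, mul_le_mul_of_nonneg_right h1.2 h3]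
    simp only [J]
    rw [integral_div, integral_add (hpi.const_mul _) (hlogi'.const_mul _), integral_const_mul,
      integral_const_mul, hM, ← mul_div_assoc]
    refine div_le_div_of_nonneg_right ?_ (by positivity)
    have := mul_le_mul_of_nonneg_left hlow (mul_nonneg hB hR0)
    linarith
  refine (ENNReal.ofReal_le_ofReal hJ).trans ((ofReal_integral_le_lintegral hJi).trans ?_)
  refine lintegral_mono_ae ?_
  filter_upwards [ae_restrict_mem Metric.isOpen_ball.measurableSet,
    ae_restrict_of_ae (ae_inner_ne_zero he)] with v hv hv0
  refine ENNReal.ofReal_le_ofReal ?_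
  have hv1 : ‖v‖ ≤ 1 := (mem_ball_zero_iff.1 hv).le
  have hiv : 0 < |(inner ℝ e v : ℝ)| := abs_pos.2 hv0
  have hiv1 : |(inner ℝ e v : ℝ)| ≤ 1 := by
    refine (abs_real_inner_le_norm _ _).trans ?_
    rwa [he, one_mul]
  set r := d * (c * |inner ℝ e v|) with hr
  have hr0 : 0 < r := by positivity
  have hr1 : r ≤ 1 := by
    rw [hr, ← mul_assoc]
    exact mul_le_one₀ hdc hiv.le hiv1
  have htan := weightSum_tangent hr0 hr1 hs0 hs1 n
  have hlog : Real.log r - Real.log s = Real.log (c * D) + Real.log (inner ℝ e v) := by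
    rw [hr, hs, Real.log_mul hd0.ne' (by positivity), Real.log_mul hc0.ne' hiv.ne',
      Real.log_div hd0.ne' hD0.ne', Real.log_mul hc0.ne' hD0.ne', Real.log_abs]
    ring
  rw [hlog] at htan
  -- The witness shows that the line leaves `Ω`; for an empty exit set `infDist` would be zero.
  have hexit0 : 0 < exitDist Ω (x, v) := by
    refine hd0.trans_le ((Metric.le_infDist ⟨W / inner ℝ e v, fun h => ?_⟩).2 fun t ht => ?_)
    · have := hslab _ h _ hx
      simp only [add_sub_cancel_left] at this
      rw [real_inner_smul_right, div_mul_cancel₀ _ hv0] at this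
      exact lt_irrefl _ this
    · rw [dist_zero_left, Real.norm_eq_abs]
      exact bdist_le_abs_of_notMem hΩ hx hv1 ht
  have hexit := abs_inner_mul_exitDist_le (v := v) hnormal
  have hJv : J v = (inner ℝ e' v) ^ (2 * m) * (A m + B m *
      (S + R * (Real.log (c * D) + Real.log (inner ℝ e v)))) / d ^ (2 * m) := by
    simp only [J]; ring
  have hSr := weightSum_nonneg n r
  rw [hJv, lineWeight, div_le_div_iff₀ (by positivity) (by positivity)]
  have h1 : (inner ℝ e' v : ℝ) ^ (2 * m) * exitDist Ω (x, v) ^ (2 * m) ≤ d ^ (2 * m) := by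
    rw [← (even_two_mul m).pow_abs, ← mul_pow]
    exact pow_le_pow_left₀ (by positivity) hexit _
  have h2 : A m + B m * (S + R * (Real.log (c * D) + Real.log (inner ℝ e v))) ≤
      A m + B m * weightSum n r := by gcongr
  -- The tangent bracket may be negative, so it is raised to the nonnegative log weight before the
  -- exit distance estimate is applied.
  calc _ = (A m + B m * (S + R * (Real.log (c * D) + Real.log (inner ℝ e v)))) *
        ((inner ℝ e' v : ℝ) ^ (2 * m) * exitDist Ω (x, v) ^ (2 * m)) := by ring
    _ ≤ (A m + B m * weightSum n r) *
        ((inner ℝ e' v : ℝ) ^ (2 * m) * exitDist Ω (x, v) ^ (2 * m)) :=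
        mul_le_mul_of_nonneg_right h2 (mul_nonneg (hpow1 v hv).1 (by positivity))
    _ ≤ _ := mul_le_mul_of_nonneg_left h1 (by positivity)

/-- The inequality with finitely many logarithmic terms, with a uniform constant `D`. -/
lemma exists_lintegral_le_energy (hN : 1 ≤ N) (m : ℕ) (hΩ : IsOpen Ω) (h0 : Ω.Nonempty)
    (hc : Convex ℝ Ω) (h1 : Ω ≠ Set.univ) (hd : BddAbove (bdist Ω '' Ω)) :
    ∃ D : ℝ, 0 < D ∧ sSup (bdist Ω '' Ω) ≤ D ∧
      ∀ (n : ℕ) (f : 𝓢(EuclideanSpace ℝ (Fin N), ℝ)), HasCompactSupport f → tsupport f ⊆ Ω →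
        ∫⁻ x in Ω, ENNReal.ofReal
          ((A m + B m * weightSum n (bdist Ω x / D)) / bdist Ω x ^ (2 * m) * f x ^ 2) ≤
          ENNReal.ofReal (energy m Ω f) := by
  have hf := frontier_nonempty h0 h1
  obtain ⟨e, W, he, hW, hslab⟩ := exists_slab hN hΩ h0 hc h1 hd
  obtain ⟨δ, hδ0, hδ1, H⟩ := lintegral_line_le m
  have hM := ballMoment_pos m he
  set c := δ / W with hcdef
  have hc0 : 0 < c := by positivity
  set Λ := ∫ v in Metric.ball (0 : EuclideanSpace ℝ (Fin N)) 1, |Real.log (inner ℝ e v)| with hΛ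
  -- Solves `ballMoment m e * log (c D₀) = Λ`, so that the logarithmic loss `Λ` is absorbed.
  set D₀ := c⁻¹ * Real.exp (Λ / ballMoment m e) with hD₀
  have hD₀0 : 0 < D₀ := by positivity
  set D := max (sSup (bdist Ω '' Ω)) D₀ with hD
  have hD0 : 0 < D := hD₀0.trans_le (le_max_right _ _)
  refine ⟨D, hD0, le_max_left _ _, ?_⟩
  have hDlog : Λ ≤ ballMoment m e * Real.log (c * D) := by
    rw [← div_le_iff₀' hM, Real.le_log_iff_exp_le (by positivity)]
    calc Real.exp (Λ / ballMoment m e) = c * D₀ := by rw [hD₀]; field_simp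
      _ ≤ c * D := mul_le_mul_of_nonneg_left (le_max_right _ _) hc0.le
  intro n f hfc hfs
  have hwm : Measurable fun p : EuclideanSpace ℝ (Fin N) × EuclideanSpace ℝ (Fin N) =>
      ENNReal.ofReal (lineWeight Ω m n c e p.1 p.2 * f p.1 ^ 2) :=
    ((measurable_lineWeight hΩ m n c e).mul
      ((f.continuous.comp continuous_fst).pow 2).measurable).ennreal_ofReal
  have hline : ∀ v : EuclideanSpace ℝ (Fin N), inner ℝ e v ≠ (0 : ℝ) → ‖v‖ ≤ 1 →
      ∫⁻ x, ENNReal.ofReal (lineWeight Ω m n c e x v * f x ^ 2) ≤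
      ∫⁻ x, ENNReal.ofReal
        (((fun g : 𝓢(EuclideanSpace ℝ (Fin N), ℝ) => ∂_{v} g)^[m] f) x ^ 2) := by
    intro v hv hv1
    have hv0 : v ≠ 0 := by
      rintro rfl
      exact hv (inner_zero_right _)
    have hm1 : Measurable fun x => ENNReal.ofReal (lineWeight Ω m n c e x v * f x ^ 2) :=
      Measurable.of_uncurry_right (f := fun x v =>
        ENNReal.ofReal (lineWeight Ω m n c e x v * f x ^ 2)) hwm
    have hm2 : Measurable fun x => ENNReal.ofReal
        (((fun g : 𝓢(EuclideanSpace ℝ (Fin N), ℝ) => ∂_{v} g)^[m] f) x ^ 2) :=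
      ((SchwartzMap.continuous _).pow 2).measurable.ennreal_ofReal
    exact lintegral_le_of_lines hm1 hm2 hv0 (H n hΩ hc hf hW hslab f hfc hfs v hv hv1)
  have hball := lintegral_ball_iterate_lineDeriv m f hfs he
  have hswap : ∫⁻ x, ∫⁻ v in Metric.ball (0 : EuclideanSpace ℝ (Fin N)) 1,
      ENNReal.ofReal (lineWeight Ω m n c e x v * f x ^ 2) ≤
      ENNReal.ofReal (ballMoment m e) * ENNReal.ofReal (energy m Ω f) := by
    rw [lintegral_lintegral_swap hwm.aemeasurable, ← hball]
    refine lintegral_mono_ae ?_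
    filter_upwards [ae_restrict_mem Metric.isOpen_ball.measurableSet,
      ae_restrict_of_ae (ae_inner_ne_zero he)] with v hv hv0
    exact hline v hv0 (mem_ball_zero_iff.1 hv).le
  have hlow : ENNReal.ofReal (ballMoment m e) * ∫⁻ x in Ω, ENNReal.ofReal
      ((A m + B m * weightSum n (bdist Ω x / D)) / bdist Ω x ^ (2 * m) * f x ^ 2) ≤
      ∫⁻ x, ∫⁻ v in Metric.ball (0 : EuclideanSpace ℝ (Fin N)) 1,
        ENNReal.ofReal (lineWeight Ω m n c e x v * f x ^ 2) := by
    rw [← lintegral_const_mul' _ _ ENNReal.ofReal_ne_top, ← lintegral_indicator hΩ.measurableSet]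
    refine lintegral_mono fun x => ?_
    by_cases hx : x ∈ Ω
    swap
    · rw [Set.indicator_of_notMem hx]
      exact zero_le
    rw [Set.indicator_of_mem hx]
    have hxD : bdist Ω x ≤ D := (le_csSup hd ⟨x, hx, rfl⟩).trans (le_max_left _ _)
    have h := ofReal_le_lintegral_lineWeight hΩ hc hf he hW hδ0 hδ1 hslab m n hD0 hDlog hx hxD
    have hsq : ∀ a : ℝ, ENNReal.ofReal (a * f x ^ 2) =
        ENNReal.ofReal a * ENNReal.ofReal (f x ^ 2) := fun a => by
      rw [mul_comm, ENNReal.ofReal_mul (sq_nonneg _), mul_comm]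
    simp only [hsq]
    rw [lintegral_mul_const' _ _ ENNReal.ofReal_ne_top, ← mul_assoc, ← ENNReal.ofReal_mul hM.le]
    gcongr
  exact (ENNReal.mul_le_mul_iff_right (ENNReal.ofReal_pos.2 hM).ne' ENNReal.ofReal_ne_top).1
    (hlow.trans hswap)

lemma energy_nonneg (m : ℕ) (u : EuclideanSpace ℝ (Fin N) → ℝ) : 0 ≤ energy m Ω u := by
  rw [energy]
  split_ifs <;> exact integral_nonneg fun x => by positivity

lemma integrableOn_mul_sq {u g : EuclideanSpace ℝ (Fin N) → ℝ}
    (hu : Continuous u) (hc : HasCompactSupport u) (hs : tsupport u ⊆ Ω)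
    (hg : ContinuousOn g Ω) : IntegrableOn (fun x => g x * u x ^ 2) Ω := by
  have hK : IntegrableOn (fun x => g x * u x ^ 2) (tsupport u) :=
    ((hg.mono hs).mul (hu.pow 2).continuousOn).integrableOn_compact hc
  have : Integrable fun x => g x * u x ^ 2 := by
    refine (integrableOn_iff_integrable_of_support_subset fun x hx => ?_).1 hK
    refine subset_tsupport u fun h => hx ?_
    simp only [h]; ring
  exact this.integrableOn

end Main

end HardyRellich

theorem theorem1 (N m : ℕ) (hN : 1 ≤ N) (hm : 1 ≤ m)
    (Ω : Set (EuclideanSpace ℝ (Fin N)))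
    (hΩ_open : IsOpen Ω) (hΩ_nonempty : Ω.Nonempty) (hΩ_convex : Convex ℝ Ω)
    (hΩ_ne_univ : Ω ≠ Set.univ)
    (hd : BddAbove (HardyRellich.bdist Ω '' Ω)) :
    ∃ D : ℝ, sSup (HardyRellich.bdist Ω '' Ω) ≤ D ∧
      ∀ u : EuclideanSpace ℝ (Fin N) → ℝ,
        ContDiff ℝ ∞ u → HasCompactSupport u → tsupport u ⊆ Ω →
          (Summable fun i : ℕ =>
            ∫ x in Ω, u x ^ 2 / HardyRellich.bdist Ω x ^ (2 * m) *
              HardyRellich.logWeight (i + 1) (HardyRellich.bdist Ω x / D)) ∧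
          HardyRellich.energy m Ω u ≥
            HardyRellich.A m * (∫ x in Ω, u x ^ 2 / HardyRellich.bdist Ω x ^ (2 * m)) +
            HardyRellich.B m * ∑' i : ℕ,
              ∫ x in Ω, u x ^ 2 / HardyRellich.bdist Ω x ^ (2 * m) *
                HardyRellich.logWeight (i + 1) (HardyRellich.bdist Ω x / D) := by
  open HardyRellich in
  obtain ⟨D, hD0, hDs, H⟩ := exists_lintegral_le_energy hN m hΩ_open hΩ_nonempty hΩ_convex
    hΩ_ne_univ hd
  refine ⟨D, hDs, fun u hu huc hus => ?_⟩
  have hf := frontier_nonempty hΩ_nonempty hΩ_ne_univ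
  have hbd : ∀ x ∈ Ω, 0 < bdist Ω x ∧ bdist Ω x / D ∈ Set.Ioc (0 : ℝ) 1 := fun x hx =>
    have h := bdist_pos hΩ_open hf hx
    ⟨h, div_pos h hD0, (div_le_one hD0).2 ((le_csSup hd ⟨x, hx, rfl⟩).trans hDs)⟩
  -- Strict positivity needs `m ≥ 1`; dividing by `B m` turns the finite inequalities into a bound
  -- on the partial sums, whence summability.
  have hB : 0 < B m := by
    obtain ⟨k, rfl⟩ : ∃ k, m = k + 1 := ⟨m - 1, by omega⟩
    rw [B_succ]
    have := A_pos k
    have := B_nonneg k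
    positivity
  have hpowc : ContinuousOn (fun x => (bdist Ω x ^ (2 * m))⁻¹) Ω :=
    (continuous_bdist.pow _).continuousOn.inv₀ fun x hx => pow_ne_zero _ (hbd x hx).1.ne'
  have hlogc : ∀ i, ContinuousOn (fun x => logWeight (i + 1) (bdist Ω x / D)) Ω := fun i => by
    simp only [logWeight_eq]
    exact ((continuousOn_logProd (i + 1)).comp (continuous_bdist.div_const D).continuousOn
      fun x hx => (hbd x hx).2).pow 2
  have hI : IntegrableOn (fun x => u x ^ 2 / bdist Ω x ^ (2 * m)) Ω := by
    refine (integrableOn_mul_sq hu.continuous huc hus hpowc).congr_fun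
      (fun x _ => ?_) hΩ_open.measurableSet
    simp only [div_eq_mul_inv, mul_comm]
  have hIi : ∀ i : ℕ, IntegrableOn
      (fun x => u x ^ 2 / bdist Ω x ^ (2 * m) * logWeight (i + 1) (bdist Ω x / D)) Ω := fun i => by
    refine (integrableOn_mul_sq hu.continuous huc hus (hpowc.mul (hlogc i))).congr_fun
      (fun x _ => ?_) hΩ_open.measurableSet
    simp only [div_eq_mul_inv, Pi.mul_apply]; ring
  have hnn : ∀ x, 0 ≤ u x ^ 2 / bdist Ω x ^ (2 * m) := fun x =>
    div_nonneg (sq_nonneg _) ((even_two_mul m).pow_nonneg _)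
  have hterm : ∀ i : ℕ, 0 ≤ ∫ x in Ω,
      u x ^ 2 / bdist Ω x ^ (2 * m) * logWeight (i + 1) (bdist Ω x / D) := fun i =>
    integral_nonneg fun x => mul_nonneg (hnn x) (by rw [logWeight_eq]; positivity)
  have hpart : ∀ n : ℕ, A m * (∫ x in Ω, u x ^ 2 / bdist Ω x ^ (2 * m)) +
      B m * ∑ i ∈ Finset.range n, ∫ x in Ω,
        u x ^ 2 / bdist Ω x ^ (2 * m) * logWeight (i + 1) (bdist Ω x / D) ≤ energy m Ω u := by
    intro n
    have h := H n (huc.toSchwartzMap hu) huc hus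
    rw [← ENNReal.ofReal_le_ofReal_iff (energy_nonneg m u), ← integral_finsetSum _ fun i _ => hIi i,
      ← integral_const_mul, ← integral_const_mul,
      ← integral_add (hI.const_mul _) ((integrable_finsetSum _ fun i _ => hIi i).const_mul _)]
    refine (ofReal_integral_le_lintegral ((hI.const_mul _).add
      ((integrable_finsetSum _ fun i _ => hIi i).const_mul _))).trans (le_trans ?_ h)
    refine lintegral_mono fun x => ENNReal.ofReal_le_ofReal (le_of_eq ?_)
    simp only [Pi.add_apply, ← Finset.mul_sum, HasCompactSupport.toSchwartzMap_toFun]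
    rw [weightSum]
    ring
  have hbound : ∀ n : ℕ, ∑ i ∈ Finset.range n, ∫ x in Ω,
      u x ^ 2 / bdist Ω x ^ (2 * m) * logWeight (i + 1) (bdist Ω x / D) ≤
      (energy m Ω u - A m * ∫ x in Ω, u x ^ 2 / bdist Ω x ^ (2 * m)) / B m := fun n => by
    rw [le_div_iff₀ hB]
    linarith [hpart n]
  refine ⟨summable_of_sum_range_le hterm hbound, ?_⟩
  have h := Real.tsum_le_of_sum_range_le hterm hbound
  rw [le_div_iff₀ hB] at h
  linarith
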